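/- Let $\mathfrak A$ be a (not necessarily unital) $C^*$-algebra and let $H,K,E$ be Hilbert $\mathfrak A$-modules. Write $\mathcal L(H,K)$ for the space of adjointable operators from $H$ to $K$ with the operator norm, $\mathcal L(H)=\mathcal L(H,H)$, and $\mathcal R(T)$ for the range of $T$. The Moore–Penrose (M-P) inverse of $T\in\mathcal L(H,K)$, if it exists, is the unique $T^\dagger\in\mathcal L(K,H)$ with $TT^\dagger T=T$, $T^\dagger TT^\dagger=T^\dagger$, $(TT^\dagger)^*=TT^\dagger$ and $(T^\dagger T)^*=T^\dagger T$; then $T$ is called M-P invertible. An element of $\mathcal L(K)$ is positive definite if it is self-adjoint, invertible in $\mathcal L(K)$ and a positive element of the $C^*$-algebra $\mathcal L(K)$. A pair $(M,N)$ of submodules of $H$ is separated if $M\cap N=\{0\}$ and $M+N$ is closed in $H$. **Theorem.** Let $A\in\mathcal L(H,K)$ and $B\in\mathcal L(H,E)$ be such that $A$ and $A^*A+B^*B$ are both M-P invertible, and let $V\in\mathcal L(K)$ and $W\in\mathcal L(E)$ be positive definite. Then there is a unique decomposition $B=B_1+B_2$ with $B_1,B_2\in\mathcal L(H,E)$ such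 that $$B_2^*WB_1=0,\qquad \mathcal R(B_1^*)\subseteq\mathcal R(A^*),\qquad \big(\mathcal R(A^*),\mathcal R(B_2^*)\big)\ \text{is a separated pair}.$$ For this decomposition and for every positive definite $W'\in\mathcal L(E)$, the operators $A^*VA+tB^*WB$ $(t>0)$, $A^*VA+B_2^*W'B_2$, $A^*VA$ and $B_2$ are M-P invertible, $2I_H-A^\dagger A-B_2^\dagger B_2$ is invertible in $\mathcal L(H)$, and, in the operator-norm topology, $$\lim_{t\to0^+}\left(A^*VA+tB^*WB\right)^\dagger A^*V=\left(A^*VA+B_2^*W'B_2\right)^\dagger A^*V=(A^*VA)^\dagger A^*V-(I_H-A^\dagger A)\,\Pi',$$ where $$\Pi'=\left(2I_H-A^\dagger A-B_2^\dagger B_2\right)^{-1}(A^*VA)^\dagger A^*V .$$ -/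

import Mathlib

open Filter Topology

noncomputable section HilbertModuleOperators

section Adjointable

variable (𝔄 : Type*) [NonUnitalCStarAlgebra 𝔄] [PartialOrder 𝔄] [StarOrderedRing 𝔄]
  (H : Type*) [NormedAddCommGroup H] [NormedSpace ℂ H] [SMul 𝔄 H] [CStarModule 𝔄 H]
  (K : Type*) [NormedAddCommGroup K] [NormedSpace ℂ K] [SMul 𝔄 K] [CStarModule 𝔄 K]

/-- The adjointable operators from `H` to `K`, inside the bounded operators (hence carrying the
operator norm). Asking for boundedness of `T` and of its adjoint is no restriction, see
`exists_mem_adjointable_of_inner_eq`. -/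
def adjointable : Submodule ℂ (H →L[ℂ] K) where
  carrier := {T | ∃ S : K →L[ℂ] H, ∀ x y, inner 𝔄 (T x) y = inner 𝔄 x (S y)}
  add_mem' := by
    rintro T₁ T₂ ⟨S₁, h₁⟩ ⟨S₂, h₂⟩
    exact ⟨S₁ + S₂, fun x y => by simp [h₁, h₂]⟩
  zero_mem' := ⟨0, fun x y => by simp⟩
  smul_mem' := by
    rintro c T ⟨S, h⟩
    exact ⟨star c • S, fun x y => by simp [h]⟩

/-- The space `𝓛(H, K)` of adjointable operators between Hilbert `𝔄`-modules, with the
operator norm. -/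
abbrev AdjOp : Type _ := adjointable 𝔄 H K

end Adjointable

variable {𝔄 : Type*} [NonUnitalCStarAlgebra 𝔄] [PartialOrder 𝔄] [StarOrderedRing 𝔄]
  {H : Type*} [NormedAddCommGroup H] [NormedSpace ℂ H] [SMul 𝔄 H] [CStarModule 𝔄 H]
  {K : Type*} [NormedAddCommGroup K] [NormedSpace ℂ K] [SMul 𝔄 K] [CStarModule 𝔄 K]
  {E : Type*} [NormedAddCommGroup E] [NormedSpace ℂ E] [SMul 𝔄 E] [CStarModule 𝔄 E]

theorem eq_of_forall_inner_eq {a b : H} (h : ∀ x : H, inner 𝔄 x a = inner 𝔄 x b) : a = b := by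
  rw [← sub_eq_zero, ← CStarModule.inner_self (A := 𝔄)]
  simp [CStarModule.inner_sub_right, h]

/-- Any map between Hilbert `𝔄`-modules that has an adjoint map is an element of `𝓛(H, K)`:
linearity and boundedness are automatic. -/
theorem exists_mem_adjointable_of_inner_eq [CompleteSpace H] [CompleteSpace K]
    (T : H → K) (S : K → H) (h : ∀ x y, inner 𝔄 (T x) y = inner 𝔄 x (S y)) :
    ∃ T' ∈ adjointable 𝔄 H K, ∀ x, T' x = T x := by
  have h' : ∀ x y, inner 𝔄 y (T x) = inner 𝔄 (S y) x := fun x y => by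
    rw [← CStarModule.star_inner (T x) y, h, CStarModule.star_inner]
  let T₀ : H →ₗ[ℂ] K :=
    { toFun := T
      map_add' := fun a b => eq_of_forall_inner_eq (𝔄 := 𝔄) fun y => by simp [h']
      map_smul' := fun c a => eq_of_forall_inner_eq (𝔄 := 𝔄) fun y => by simp [h'] }
  let S₀ : K →ₗ[ℂ] H :=
    { toFun := S
      map_add' := fun a b => eq_of_forall_inner_eq (𝔄 := 𝔄) fun y => by simp [← h]
      map_smul' := fun c a => eq_of_forall_inner_eq (𝔄 := 𝔄) fun y => by simp [← h] }
  have hT : Continuous T₀ := by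
    refine T₀.continuous_of_seq_closed_graph fun u x y hu hTu =>
      eq_of_forall_inner_eq (𝔄 := 𝔄) fun z => ?_
    have h1 := ((CStarModule.innerSL (A := 𝔄) z).continuous.tendsto y).comp hTu
    have h2 := ((CStarModule.innerSL (A := 𝔄) (S z)).continuous.tendsto x).comp hu
    refine (tendsto_nhds_unique h1 (h2.congr fun n => ?_)).trans (h' x z).symm
    exact (h' (u n) z).symm
  have hS : Continuous S₀ := by
    refine S₀.continuous_of_seq_closed_graph fun u x y hu hTu =>
      eq_of_forall_inner_eq (𝔄 := 𝔄) fun z => ?_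
    have h1 := ((CStarModule.innerSL (A := 𝔄) z).continuous.tendsto y).comp hTu
    have h2 := ((CStarModule.innerSL (A := 𝔄) (T z)).continuous.tendsto x).comp hu
    refine (tendsto_nhds_unique h1 (h2.congr fun n => ?_)).trans (h z x)
    exact h z (u n)
  exact ⟨⟨T₀, hT⟩, ⟨⟨S₀, hS⟩, h⟩, fun _ => rfl⟩

namespace AdjOp

/-- The adjoint `T*` of an adjointable operator. -/
def adj (T : AdjOp 𝔄 H K) : AdjOp 𝔄 K H :=
  ⟨T.2.choose, T.1, fun x y => by
    rw [← CStarModule.star_inner, ← T.2.choose_spec, CStarModule.star_inner]⟩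

/-- The defining property of `T*` (which determines it, by `eq_of_forall_inner_eq`). -/
theorem inner_adj (T : AdjOp 𝔄 H K) (x : H) (y : K) :
    inner 𝔄 (T.1 x) y = inner 𝔄 x (T.adj.1 y) :=
  T.2.choose_spec x y

/-- The composition (product) `T S` of adjointable operators. -/
def comp (T : AdjOp 𝔄 K E) (S : AdjOp 𝔄 H K) : AdjOp 𝔄 H E :=
  ⟨T.1.comp S.1, S.adj.1.comp T.adj.1, fun x y => by simp [inner_adj]⟩

variable (𝔄 H) in
/-- The identity operator `I_H`. -/
def idOp : AdjOp 𝔄 H H := ⟨ContinuousLinearMap.id ℂ H, ContinuousLinearMap.id ℂ H, by simp⟩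

/-- The range of `T`. -/
def ran (T : AdjOp 𝔄 H K) : Submodule ℂ K := LinearMap.range (T.1 : H →ₗ[ℂ] K)

end AdjOp

/-- Product of adjointable operators. -/
infixr:75 " ⬝ " => AdjOp.comp

/-- `X` is a two-sided inverse of `T` in `𝓛(H)`. -/
def AdjOp.IsInverse (T X : AdjOp 𝔄 H H) : Prop :=
  X ⬝ T = AdjOp.idOp 𝔄 H ∧ T ⬝ X = AdjOp.idOp 𝔄 H

/-- `T` is invertible in `𝓛(H)`. -/
def AdjOp.Invertible (T : AdjOp 𝔄 H H) : Prop := ∃ X, T.IsInverse X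

open Classical in
/-- The inverse `T⁻¹` in `𝓛(H)`; the value is `0` when `T` is not invertible. -/
def AdjOp.inverse (T : AdjOp 𝔄 H H) : AdjOp 𝔄 H H :=
  if h : T.Invertible then h.choose else 0

/-- `M` is positive definite: self-adjoint, invertible in `𝓛(H)`, and a positive element of the
C⋆-algebra `𝓛(H)`, that is, of the form `S* S` with `S ∈ 𝓛(H)`. -/
structure AdjOp.PosDefinite (M : AdjOp 𝔄 H H) : Prop where
  selfAdjoint : M.adj = M
  invertible : M.Invertible
  positive : ∃ S : AdjOp 𝔄 H H, M = S.adj ⬝ S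

/-- `X` is a Moore–Penrose inverse of `T`: the four Penrose equations. -/
structure AdjOp.IsMPInverse (T : AdjOp 𝔄 H K) (X : AdjOp 𝔄 K H) : Prop where
  mul_mul_self : T ⬝ X ⬝ T = T
  self_mul_mul : X ⬝ T ⬝ X = X
  adj_left : (T ⬝ X).adj = T ⬝ X
  adj_right : (X ⬝ T).adj = X ⬝ T

/-- `T` has a Moore–Penrose inverse. -/
def AdjOp.MPInvertible (T : AdjOp 𝔄 H K) : Prop := ∃ X, T.IsMPInverse X

open Classical in
/-- The Moore–Penrose inverse `T†`; the value is `0` when `T` is not M-P invertible. -/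
def AdjOp.mpInv (T : AdjOp 𝔄 H K) : AdjOp 𝔄 K H :=
  if h : T.MPInvertible then h.choose else 0

/-- `(M, N)` is a separated pair of submodules: `M ∩ N = {0}` and `M + N` is closed. -/
def IsSeparatedPair (M N : Submodule ℂ H) : Prop :=
  M ⊓ N = ⊥ ∧ IsClosed ((M ⊔ N : Submodule ℂ H) : Set H)

/-- `B = B₁ + B₂` with `B₂* W B₁ = 0`, `R(B₁*) ⊆ R(A*)` and `(R(A*), R(B₂*))` separated. -/
structure IsSeparatedDecomposition (A : AdjOp 𝔄 H K) (B : AdjOp 𝔄 H E) (W : AdjOp 𝔄 E E)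
    (B₁ B₂ : AdjOp 𝔄 H E) : Prop where
  eq_add : B = B₁ + B₂
  orthogonal : B₂.adj ⬝ W ⬝ B₁ = 0
  range_le : B₁.adj.ran ≤ A.adj.ran
  separated : IsSeparatedPair A.adj.ran B₂.adj.ran

end HilbertModuleOperators

/-! ### The C⋆-algebra `𝓛(H)` and positivity of `S* S` between different modules. -/

noncomputable section HilbertModuleCStar

set_option linter.unusedSectionVars false

variable {𝔄 : Type*} [NonUnitalCStarAlgebra 𝔄] [PartialOrder 𝔄] [StarOrderedRing 𝔄]
  {H : Type*} [NormedAddCommGroup H] [NormedSpace ℂ H] [SMul 𝔄 H] [CStarModule 𝔄 H]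
  {K : Type*} [NormedAddCommGroup K] [NormedSpace ℂ K] [SMul 𝔄 K] [CStarModule 𝔄 K]
  {E : Type*} [NormedAddCommGroup E] [NormedSpace ℂ E] [SMul 𝔄 E] [CStarModule 𝔄 E]
  {L : Type*} [NormedAddCommGroup L] [NormedSpace ℂ L] [SMul 𝔄 L] [CStarModule 𝔄 L]

namespace AdjOp

/-! The problem becomes block-diagonal. Let `P = A†A` and let `p` be the support projection of `A*A
+ B*B`. Then `R = p - P` is a projection orthogonal to `P` with `AR = 0` and `B(P + R) = B`.
Compressing `c p ≤ A*A + B*B` to `R` shows `B*B` bounded below there, so `(BR)*W(BR)` has an inverse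
`G` in the corner of `R` (`exists_complementary_projection`, `exists_isComplementaryCorner`).

The operator `F = G B*WB` is idempotent with `RF = F` and `FR = R`. The decomposition is `B₂ = BF`,
`B₁ = B(1 - F)`: `B₁` kills `R`, hence lives on `P`, and `B*WB F` is self-adjoint, which gives
orthogonality.

Put `L = P + F = (P + R) + FP`, invertible on `P + R` with inverse `P + R - FP`. As `AL = A`, `B₁L =
B₁` and `RL = F`, both `A*VA + tB*WB` and `A*VA + B₂*W'B₂` are `L*(m + m')L` with `m` in the corner
of `P` and `m'` in that of `R` (`conj_weighted_sum`, `conj_eq`). Their Moore–Penrose inverses follow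
from `unipotent_conj`. Multiplied by `A*V`, the `R` block, including its singular factor `1/t`,
disappears, leaving `(1 - F) m† A*V` (`inverse_comp_adj`). Here `m = A*VA + tB₁*WB₁` tends to `A*VA`
inside a fixed corner, where inversion is continuous.

The closed form rests on `(1 - P) S P = FP` for `S = (2 - P - B₂†B₂)⁻¹` (`compl_mul_inverse_gap`).
-/

theorem ext_apply {S T : AdjOp 𝔄 H K} (h : ∀ x, S.1 x = T.1 x) : S = T :=
  Subtype.ext (ContinuousLinearMap.ext h)

theorem eq_adj_of_inner {T : AdjOp 𝔄 H K} {S : AdjOp 𝔄 K H}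
    (h : ∀ x y, inner 𝔄 (T.1 x) y = inner 𝔄 x (S.1 y)) : T.adj = S :=
  ext_apply fun y => eq_of_forall_inner_eq (𝔄 := 𝔄) fun x => by rw [← inner_adj, h]

theorem inner_adj_left (T : AdjOp 𝔄 H K) (x : H) (y : K) :
    inner 𝔄 (T.adj.1 y) x = inner 𝔄 y (T.1 x) := by
  rw [← CStarModule.star_inner, ← inner_adj, CStarModule.star_inner]

@[simp] theorem comp_apply (T : AdjOp 𝔄 K E) (S : AdjOp 𝔄 H K) (x : H) :
    (T ⬝ S).1 x = T.1 (S.1 x) := rfl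

@[simp] theorem idOp_apply (x : H) : (idOp 𝔄 H).1 x = x := rfl

@[simp] theorem adj_adj (T : AdjOp 𝔄 H K) : T.adj.adj = T :=
  eq_adj_of_inner fun x y => inner_adj_left T y x

@[simp] theorem adj_comp (T : AdjOp 𝔄 K E) (S : AdjOp 𝔄 H K) :
    (T ⬝ S).adj = S.adj ⬝ T.adj :=
  eq_adj_of_inner fun x y => by simp [inner_adj]

@[simp] theorem adj_add (S T : AdjOp 𝔄 H K) : (S + T).adj = S.adj + T.adj :=
  eq_adj_of_inner fun x y => by simp [inner_adj]

@[simp] theorem adj_sub (S T : AdjOp 𝔄 H K) : (S - T).adj = S.adj - T.adj :=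
  eq_adj_of_inner fun x y => by simp [inner_adj]

@[simp] theorem adj_zero : (0 : AdjOp 𝔄 H K).adj = 0 :=
  eq_adj_of_inner fun x y => by simp

@[simp] theorem adj_smul (c : ℂ) (T : AdjOp 𝔄 H K) : (c • T).adj = star c • T.adj :=
  eq_adj_of_inner fun x y => by simp [inner_adj]

@[simp] theorem adj_idOp : (idOp 𝔄 H).adj = idOp 𝔄 H :=
  eq_adj_of_inner fun x y => by simp

theorem comp_assoc (T : AdjOp 𝔄 E L) (S : AdjOp 𝔄 K E) (R : AdjOp 𝔄 H K) :
    (T ⬝ S) ⬝ R = T ⬝ S ⬝ R := rfl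

@[simp] theorem idOp_comp (T : AdjOp 𝔄 H K) : idOp 𝔄 K ⬝ T = T := rfl

@[simp] theorem comp_idOp (T : AdjOp 𝔄 H K) : T ⬝ idOp 𝔄 H = T := rfl

theorem add_comp (S T : AdjOp 𝔄 K E) (R : AdjOp 𝔄 H K) : (S + T) ⬝ R = S ⬝ R + T ⬝ R := rfl

theorem sub_comp (S T : AdjOp 𝔄 K E) (R : AdjOp 𝔄 H K) : (S - T) ⬝ R = S ⬝ R - T ⬝ R := rfl

theorem comp_add (T : AdjOp 𝔄 K E) (S R : AdjOp 𝔄 H K) : T ⬝ (S + R) = T ⬝ S + T ⬝ R :=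
  ext_apply fun _ => map_add T.1 _ _

theorem comp_sub (T : AdjOp 𝔄 K E) (S R : AdjOp 𝔄 H K) : T ⬝ (S - R) = T ⬝ S - T ⬝ R :=
  ext_apply fun _ => map_sub T.1 _ _

@[simp] theorem smul_comp (c : ℂ) (T : AdjOp 𝔄 K E) (S : AdjOp 𝔄 H K) :
    (c • T) ⬝ S = c • (T ⬝ S) := rfl

@[simp] theorem comp_smul (c : ℂ) (T : AdjOp 𝔄 K E) (S : AdjOp 𝔄 H K) :
    T ⬝ (c • S) = c • (T ⬝ S) :=
  ext_apply fun _ => map_smul T.1 _ _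

@[simp] theorem zero_comp (S : AdjOp 𝔄 H K) : (0 : AdjOp 𝔄 K E) ⬝ S = 0 := rfl

@[simp] theorem comp_zero (T : AdjOp 𝔄 K E) : T ⬝ (0 : AdjOp 𝔄 H K) = 0 :=
  ext_apply fun _ => map_zero T.1

theorem norm_comp_le (T : AdjOp 𝔄 K E) (S : AdjOp 𝔄 H K) : ‖T ⬝ S‖ ≤ ‖T‖ * ‖S‖ :=
  ContinuousLinearMap.opNorm_comp_le T.1 S.1

theorem sq_norm_le_norm_adj_comp_self (T : AdjOp 𝔄 H K) : ‖T‖ * ‖T‖ ≤ ‖T.adj ⬝ T‖ := by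
  have h : ‖T‖ ≤ √‖T.adj ⬝ T‖ := by
    refine ContinuousLinearMap.opNorm_le_bound _ (Real.sqrt_nonneg _) fun x => ?_
    change ‖T.1 x‖ ≤ _
    refine (Real.le_sqrt_of_sq_le ?_ : _ ≤ √(‖T.adj ⬝ T‖ * ‖x‖ ^ 2)).trans_eq ?_
    · rw [CStarModule.norm_sq_eq (A := 𝔄), inner_adj]
      refine (CStarModule.norm_inner_le H).trans ?_
      have := (T.adj ⬝ T).1.le_opNorm x
      calc ‖x‖ * ‖T.adj.1 (T.1 x)‖ ≤ ‖x‖ * (‖T.adj ⬝ T‖ * ‖x‖) := by gcongr; exact this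
        _ = _ := by ring
    · rw [Real.sqrt_mul (norm_nonneg (T.adj ⬝ T)), Real.sqrt_sq (norm_nonneg x)]
  calc ‖T‖ * ‖T‖ ≤ √‖T.adj ⬝ T‖ * √‖T.adj ⬝ T‖ := by gcongr
    _ = _ := Real.mul_self_sqrt (norm_nonneg _)

theorem norm_le_norm_adj (T : AdjOp 𝔄 H K) : ‖T‖ ≤ ‖T.adj‖ := by
  rcases (norm_nonneg T).eq_or_lt with h | h
  · rw [← h]; exact norm_nonneg _
  · exact le_of_mul_le_mul_right
      ((sq_norm_le_norm_adj_comp_self T).trans (norm_comp_le _ _)) h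

@[simp] theorem norm_adj (T : AdjOp 𝔄 H K) : ‖T.adj‖ = ‖T‖ :=
  le_antisymm (by simpa using norm_le_norm_adj T.adj) (norm_le_norm_adj T)

-- The adjoint is isometric, so the adjoints of a Cauchy sequence converge too, and their limit is
-- the adjoint of the limit.
scoped instance [CompleteSpace H] [CompleteSpace K] : CompleteSpace (AdjOp 𝔄 H K) := by
  refine Metric.complete_of_cauchySeq_tendsto fun u hu => ?_
  have hu' : CauchySeq fun n => (u n).adj := by
    rw [Metric.cauchySeq_iff] at hu ⊢
    have h (m n : ℕ) : dist (u m).adj (u n).adj = dist (u m) (u n) := by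
      rw [dist_eq_norm, ← adj_sub, dist_eq_norm]
      exact norm_adj _
    simpa only [h] using hu
  have hv : CauchySeq fun n => (u n).1 := uniformContinuous_subtype_val.comp_cauchySeq hu
  have hv' : CauchySeq fun n => (u n).adj.1 := uniformContinuous_subtype_val.comp_cauchySeq hu'
  obtain ⟨T, hT⟩ := cauchySeq_tendsto_of_complete hv
  obtain ⟨S, hS⟩ := cauchySeq_tendsto_of_complete hv'
  refine ⟨⟨T, S, fun x y => ?_⟩, tendsto_subtype_rng.2 hT⟩
  have hTx : Tendsto (fun n => (u n).1 x) atTop (𝓝 (T x)) :=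
    ((ContinuousLinearMap.apply ℂ K x).continuous.tendsto T).comp hT
  have hSy : Tendsto (fun n => (u n).adj.1 y) atTop (𝓝 (S y)) :=
    ((ContinuousLinearMap.apply ℂ H y).continuous.tendsto S).comp hS
  have h1 := (CStarModule.continuous_inner (A := 𝔄) (E := K)).tendsto (T x, y) |>.comp
    (hTx.prodMk_nhds tendsto_const_nhds)
  have h2 := (CStarModule.continuous_inner (A := 𝔄) (E := H)).tendsto (x, S y) |>.comp
    (tendsto_const_nhds.prodMk_nhds hSy)
  exact tendsto_nhds_unique (h1.congr fun n => inner_adj (u n) x y) h2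

scoped instance : NormedRing (AdjOp 𝔄 H H) where
  __ := Submodule.normedAddCommGroup (adjointable 𝔄 H H)
  mul := comp
  one := idOp 𝔄 H
  mul_assoc _ _ _ := rfl
  one_mul _ := rfl
  mul_one _ := rfl
  zero_mul _ := rfl
  mul_zero := comp_zero
  left_distrib := comp_add
  right_distrib _ _ _ := rfl
  norm_mul_le := norm_comp_le

scoped instance : StarRing (AdjOp 𝔄 H H) where
  star := adj
  star_involutive := adj_adj
  star_mul := adj_comp
  star_add := adj_add

theorem adj_eq_star (T : AdjOp 𝔄 H H) : T.adj = star T := rfl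

scoped instance : NormedAlgebra ℂ (AdjOp 𝔄 H H) where
  __ := Algebra.ofModule (R := ℂ) (A := AdjOp 𝔄 H H) (fun _ _ _ => rfl) comp_smul
  norm_smul_le c T := norm_smul_le c T.1

scoped instance [CompleteSpace H] : CStarAlgebra (AdjOp 𝔄 H H) where
  norm_mul_self_le := sq_norm_le_norm_adj_comp_self
  star_smul := adj_smul

scoped instance [CompleteSpace H] : PartialOrder (AdjOp 𝔄 H H) := CStarAlgebra.spectralOrder _

scoped instance [CompleteSpace H] : StarOrderedRing (AdjOp 𝔄 H H) :=
  CStarAlgebra.spectralOrderedRing _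

theorem adj_comp_self_add_eq_zero {S : AdjOp 𝔄 H K} {T : AdjOp 𝔄 H E}
    (h : S.adj ⬝ S + T.adj ⬝ T = 0) : T = 0 := by
  refine ext_apply fun x => ?_
  have h0 : inner 𝔄 (S.1 x) (S.1 x) + inner 𝔄 (T.1 x) (T.1 x) = (0 : 𝔄) := by
    rw [inner_adj, inner_adj, ← CStarModule.inner_add_right]
    have := congrArg (fun Z : AdjOp 𝔄 H H => Z.1 x) h
    exact (congrArg (inner 𝔄 x) this).trans (by simp)
  have h1 := (add_eq_zero_iff_of_nonneg CStarModule.inner_self_nonneg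
    CStarModule.inner_self_nonneg).1 h0
  simpa using CStarModule.inner_self.1 h1.2

/-- For `K ≠ H` this is not a square in the algebra `𝓛(H)`. With `a = S* S` and `a⁻ = s* s`, the
squares of `S a⁻` and `s a⁻` are `a⁻ a a⁻ = -(a⁻)³` and `(a⁻)³`. Their sum vanishes, so positivity
of the inner product forces `s a⁻ = 0` and hence `a⁻ = 0`. -/
theorem adj_comp_self_nonneg [CompleteSpace H] (S : AdjOp 𝔄 H K) : 0 ≤ S.adj ⬝ S := by
  set a : AdjOp 𝔄 H H := S.adj ⬝ S with ha
  have hsa : IsSelfAdjoint a := by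
    change a.adj = a
    simp [ha]
  have hn : 0 ≤ a⁻ := CFC.negPart_nonneg a
  have hns : star a⁻ = a⁻ := hn.isSelfAdjoint.star_eq
  have hna : a⁻ * a * a⁻ = -(a⁻ * a⁻ * a⁻) := by
    conv_lhs => enter [1, 2]; rw [← CFC.posPart_sub_negPart a hsa]
    rw [mul_sub, CFC.negPart_mul_posPart]
    noncomm_ring
  obtain ⟨s, hs⟩ := CStarAlgebra.nonneg_iff_eq_star_mul_self.1 hn
  have h3 : (s * a⁻).adj ⬝ (s * a⁻) = a⁻ * a⁻ * a⁻ := by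
    change star (s * a⁻) * (s * a⁻) = _
    rw [star_mul, hns, mul_assoc, ← mul_assoc (star s), ← hs, mul_assoc]
  have h4 : (S ⬝ a⁻).adj ⬝ (S ⬝ a⁻) = a⁻ * a * a⁻ := by
    rw [adj_comp, adj_eq_star, hns]; rfl
  have h5 : s * a⁻ = 0 := adj_comp_self_add_eq_zero (S := S ⬝ a⁻) (by rw [h3, h4, hna]; simp)
  have h6 : star a⁻ * a⁻ = 0 := by
    rw [hns]; nth_rw 1 [hs]; rw [mul_assoc, h5, mul_zero]
  rw [← CFC.negPart_eq_zero_iff a hsa]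
  exact CStarRing.star_mul_self_eq_zero_iff _ |>.1 h6

theorem conj_nonneg [CompleteSpace H] [CompleteSpace K] {M : AdjOp 𝔄 K K} (hM : 0 ≤ M)
    (S : AdjOp 𝔄 H K) : 0 ≤ S.adj ⬝ M ⬝ S := by
  obtain ⟨s, rfl⟩ := CStarAlgebra.nonneg_iff_eq_star_mul_self.1 hM
  have := adj_comp_self_nonneg (s ⬝ S)
  rwa [adj_comp] at this

theorem conj_mono [CompleteSpace H] [CompleteSpace K] {M N : AdjOp 𝔄 K K} (h : M ≤ N)
    (S : AdjOp 𝔄 H K) : S.adj ⬝ M ⬝ S ≤ S.adj ⬝ N ⬝ S := by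
  have := conj_nonneg (sub_nonneg.2 h) S
  rwa [sub_comp, comp_sub, sub_nonneg] at this

end AdjOp

end HilbertModuleCStar

/-! ### Inverses in corners and lower bounds in C⋆-algebras. -/

noncomputable section HilbertModuleCorners

section CornerAlgebra

/-- `x` is the inverse of `m` in the corner cut out by the projection `p`. -/
structure IsCornerInverse {R : Type*} [Ring R] [StarRing R] (p m x : R) : Prop where
  star_eq : star p = p
  mul_inv : m * x = p
  inv_mul : x * m = p
  proj_mul : p * m = m
  proj_mul_inv : p * x = x

namespace IsCornerInverse

variable {R : Type*} [Ring R] [StarRing R] {p m x q n y : R}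

theorem mul_proj (h : IsCornerInverse p m x) : m * p = m := by
  rw [← h.inv_mul, ← mul_assoc, h.mul_inv, h.proj_mul]

theorem inv_mul_proj (h : IsCornerInverse p m x) : x * p = x := by
  rw [← h.mul_inv, ← mul_assoc, h.inv_mul, h.proj_mul_inv]

theorem proj_mul_proj (h : IsCornerInverse p m x) : p * p = p := by
  nth_rw 2 [← h.mul_inv]
  rw [← mul_assoc, h.proj_mul, h.mul_inv]

theorem star_inv (h : IsCornerInverse p m x) (hm : star m = m) : star x = x := by
  have h1 : star x * m = p := by rw [← h.star_eq, ← h.mul_inv, star_mul, hm]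
  have h2 : star x * p = star x := by rw [← h.star_eq, ← star_mul, h.proj_mul_inv]
  rw [← h2, ← h.mul_inv, ← mul_assoc, h1, h.proj_mul_inv]

/-- Complementing a corner inverse by the identity of the opposite corner. -/
theorem isUnit_add_compl (h : IsCornerInverse p m x) : IsUnit (m + (1 - p)) := by
  refine ⟨⟨m + (1 - p), x + (1 - p), ?_, ?_⟩, rfl⟩
  · have : (m + (1 - p)) * (x + (1 - p)) =
        m * x + (m - m * p) + (x - p * x) + (1 - p - p + p * p) := by noncomm_ring
    rw [this, h.mul_proj, h.proj_mul_inv, h.mul_inv, h.proj_mul_proj]; noncomm_ring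
  · have : (x + (1 - p)) * (m + (1 - p)) =
        x * m + (x - x * p) + (m - p * m) + (1 - p - p + p * p) := by noncomm_ring
    rw [this, h.inv_mul_proj, h.proj_mul, h.inv_mul, h.proj_mul_proj]; noncomm_ring

/-- A block-diagonal element of two orthogonal corners, conjugated by the unipotent element
`p + q + n` with `n` in the off-diagonal corner, is invertible in the sum of the corners. -/
theorem unipotent_conj (hp : IsCornerInverse p m x) {m' x' : R} (hq : IsCornerInverse q m' x')
    (hpq : p * q = 0) (hn : q * n = n) (hn' : n * p = n) :
    IsCornerInverse (p + q) (star (p + q + n) * (m + m') * (p + q + n))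
      ((p + q - n) * (x + x') * star (p + q - n)) := by
  have hqp : q * p = 0 := by
    rw [← hq.star_eq, ← hp.star_eq, ← star_mul, hpq, star_zero]
  have hpn : p * n = 0 := by rw [← hn, ← mul_assoc, hpq, zero_mul]
  have hnq : n * q = 0 := by rw [← hn', mul_assoc, hpq, mul_zero]
  have hnn : n * n = 0 := by nth_rw 1 [← hn']; rw [mul_assoc, hpn, mul_zero]
  have hpp := hp.proj_mul_proj
  have hqq := hq.proj_mul_proj
  have hss : star (p + q) = p + q := by rw [star_add, hp.star_eq, hq.star_eq]
  -- Because `n² = 0`, changing the sign of `n` inverts the unipotent factor relative to the unit `p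
  -- + q`.
  have h1 : (p + q + n) * (p + q - n) = p + q := by
    simp only [mul_add, add_mul, mul_sub, hpp, hqq, hpq, hqp, hpn, hnq, hnn, hn, hn']; abel
  have h2 : (p + q - n) * (p + q + n) = p + q := by
    simp only [mul_add, sub_mul, add_mul, hpp, hqq, hpq, hqp, hpn, hnq, hnn, hn, hn']; abel
  have h1s : star (p + q - n) * star (p + q + n) = p + q := by rw [← star_mul, h1, hss]
  have h2s : star (p + q + n) * star (p + q - n) = p + q := by rw [← star_mul, h2, hss]
  have hmq : m * q = 0 := by rw [← hp.mul_proj, mul_assoc, hpq, mul_zero]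
  have hm'p : m' * p = 0 := by rw [← hq.mul_proj, mul_assoc, hqp, mul_zero]
  have hxq : x * q = 0 := by rw [← hp.inv_mul_proj, mul_assoc, hpq, mul_zero]
  have hx'p : x' * p = 0 := by rw [← hq.inv_mul_proj, mul_assoc, hqp, mul_zero]
  have hmx' : m * x' = 0 := by rw [← hq.proj_mul_inv, ← mul_assoc, hmq, zero_mul]
  have hm'x : m' * x = 0 := by rw [← hp.proj_mul_inv, ← mul_assoc, hm'p, zero_mul]
  have hxm' : x * m' = 0 := by rw [← hq.proj_mul, ← mul_assoc, hxq, zero_mul]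
  have hx'm : x' * m = 0 := by rw [← hp.proj_mul, ← mul_assoc, hx'p, zero_mul]
  have h3 : (m + m') * (p + q) = m + m' := by
    simp only [mul_add, add_mul, hp.mul_proj, hq.mul_proj, hmq, hm'p]; abel
  have h4 : (x + x') * (p + q) = x + x' := by
    simp only [mul_add, add_mul, hp.inv_mul_proj, hq.inv_mul_proj, hxq, hx'p]; abel
  have h5 : (m + m') * (x + x') = p + q := by
    simp only [mul_add, add_mul, hp.mul_inv, hq.mul_inv, hmx', hm'x]; abel
  have h6 : (x + x') * (m + m') = p + q := by
    simp only [mul_add, add_mul, hp.inv_mul, hq.inv_mul, hxm', hx'm]; abel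
  have h7 : (p + q) * (p + q - n) = p + q - n := by
    simp only [mul_add, add_mul, mul_sub, hpp, hqq, hpq, hqp, hpn, hn]; abel
  have h8 : (p + q) * star (p + q + n) = star (p + q + n) := by
    rw [← hss, ← star_mul, hss]
    congr 1
    simp only [mul_add, add_mul, hpp, hqq, hpq, hqp, hnq, hn']; abel
  have h9 : (p + q) * (p + q + n) = p + q + n := by
    simp only [mul_add, add_mul, hpp, hqq, hpq, hqp, hpn, hn]; abel
  have h10 : (p + q) * star (p + q - n) = star (p + q - n) := by
    rw [← hss, ← star_mul, hss]
    congr 1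
    simp only [mul_add, add_mul, sub_mul, hpp, hqq, hpq, hqp, hnq, hn']; abel
  generalize p + q + n = a at *
  generalize p + q - n = b at *
  generalize p + q = r at *
  generalize m + m' = c at *
  generalize x + x' = d at *
  refine ⟨hss, ?_, ?_, ?_, ?_⟩
  · calc star a * c * a * (b * d * star b) = star a * (c * (a * b)) * d * star b := by
          simp only [mul_assoc]
      _ = star a * (c * d * star b) := by rw [h1, h3]; simp only [mul_assoc]
      _ = r := by rw [h5, h10, h2s]
  · calc b * d * star b * (star a * c * a) = b * (d * (star b * star a)) * c * a := by
          simp only [mul_assoc]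
      _ = b * (d * c * a) := by rw [h1s, h4]; simp only [mul_assoc]
      _ = r := by rw [h6, h9, h2]
  · rw [← mul_assoc, ← mul_assoc, h8]
  · rw [← mul_assoc, ← mul_assoc, h7]

end IsCornerInverse

variable {R : Type*} [CStarAlgebra R]

open Ring in
theorem IsCornerInverse.of_isUnit {p m : R} (hp : star p = p) (hpp : p * p = p)
    (hpm : p * m = m) (hmp : m * p = m) (hu : IsUnit (m + (1 - p))) :
    IsCornerInverse p m (p * (m + (1 - p))⁻¹ʳ) := by
  set z := m + (1 - p) with hz
  have h1 : p * z = m := by rw [hz, mul_add, mul_sub, hpm, hpp, mul_one]; abel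
  have h2 : z * p = m := by rw [hz, add_mul, sub_mul, hmp, hpp, one_mul]; abel
  have h3 : z⁻¹ʳ * p = p * z⁻¹ʳ := by
    calc z⁻¹ʳ * p = z⁻¹ʳ * (p * z) * z⁻¹ʳ := by
          rw [mul_assoc, mul_assoc, Ring.mul_inverse_cancel _ hu, mul_one]
      _ = z⁻¹ʳ * z * p * z⁻¹ʳ := by rw [h1, ← h2, ← mul_assoc]
      _ = _ := by rw [Ring.inverse_mul_cancel _ hu, one_mul]
  refine ⟨hp, ?_, ?_, hpm, ?_⟩
  · rw [← mul_assoc, hmp, ← h1, mul_assoc, Ring.mul_inverse_cancel _ hu, mul_one]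
  · rw [← h3, mul_assoc, hpm, ← h2, ← mul_assoc, Ring.inverse_mul_cancel _ hu, one_mul]
  · rw [← mul_assoc, hpp]

variable [PartialOrder R] [StarOrderedRing R]

theorem isUnit_of_smul_one_le {m : R} {c : ℝ} (hc : 0 < c) (h : c • (1 : R) ≤ m) : IsUnit m := by
  have hu : IsUnit (c • (1 : R)) := by
    rw [← Algebra.algebraMap_eq_smul_one]
    exact (IsUnit.mk0 c hc.ne').map (algebraMap ℝ R)
  exact CStarAlgebra.isUnit_of_le _ h (hu.isStrictlyPositive (smul_nonneg hc.le zero_le_one))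

theorem exists_smul_one_le {m : R} (hm : 0 ≤ m) (hu : IsUnit m) :
    ∃ c : ℝ, 0 < c ∧ c • (1 : R) ≤ m := by
  nontriviality R using exists_gt
  obtain ⟨c, hc, h⟩ := (CFC.exists_pos_algebraMap_le_iff hm.isSelfAdjoint).2
    fun x hx => (hu.isStrictlyPositive hm).spectrum_pos hx
  exact ⟨c, hc, by rwa [Algebra.algebraMap_eq_smul_one] at h⟩

/-- The parallelogram law gives `1 = (u + v)*(u + v) ≤ 2(u*u + v*v)`, so `z + w` is bounded below by
a positive multiple of `1`. -/
theorem isUnit_add_of_add_eq_one {u v z w : R} {c d : ℝ} (huv : u + v = 1)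
    (hz : 0 ≤ z) (hw : 0 ≤ w) (hu : star u * u ≤ c • z) (hv : star v * v ≤ d • w) :
    IsUnit (z + w) := by
  have h1 : (1 : R) ≤ (2 : ℝ) • (star u * u + star v * v) := by
    have h2 := star_mul_self_nonneg (u - v)
    have h3 : (2 : ℝ) • (star u * u + star v * v) =
        star (u + v) * (u + v) + star (u - v) * (u - v) := by
      rw [two_smul, star_add, star_sub]; noncomm_ring
    rw [h3, huv]
    simpa using h2
  set b := max 1 (max c d) with hb
  have hb0 : 0 < b := lt_of_lt_of_le one_pos (le_max_left _ _)
  have h4 : (1 : R) ≤ (2 * b) • (z + w) := by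
    refine h1.trans ?_
    rw [mul_smul]
    refine smul_le_smul_of_nonneg_left ?_ zero_le_two
    rw [smul_add]
    exact add_le_add
      (hu.trans (smul_le_smul_of_nonneg_right ((le_max_left _ _).trans (le_max_right _ _)) hz))
      (hv.trans (smul_le_smul_of_nonneg_right ((le_max_right _ _).trans (le_max_right _ _)) hw))
  have hc : 0 < 2 * b := by positivity
  refine isUnit_of_smul_one_le (inv_pos.2 hc) ?_
  rwa [inv_smul_le_iff_of_pos hc]

theorem one_sub_nonneg_of_isProj {p : R} (hp : star p = p) (hpp : p * p = p) : 0 ≤ 1 - p := by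
  have : 1 - p = star (1 - p) * (1 - p) := by
    rw [star_sub, star_one, hp, mul_sub, sub_mul, mul_one, sub_mul, hpp]; simp
  rw [this]; exact star_mul_self_nonneg _

theorem isUnit_add_compl_of_smul_le {p m : R} (hp : star p = p) (hpp : p * p = p) {c : ℝ} (hc : 0 < c) (h : c • p ≤ m) :
    IsUnit (m + (1 - p)) := by
  have h1 := one_sub_nonneg_of_isProj hp hpp
  have h0 : 0 ≤ p := by rw [← hpp]; nth_rw 1 [← hp]; exact star_mul_self_nonneg _
  refine isUnit_of_smul_one_le (c := min c 1) (by positivity) ?_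
  calc min c 1 • (1 : R) = min c 1 • p + min c 1 • (1 - p) := by rw [← smul_add]; simp
    _ ≤ c • p + (1 : ℝ) • (1 - p) := add_le_add
        (smul_le_smul_of_nonneg_right (min_le_left _ _) h0)
        (smul_le_smul_of_nonneg_right (min_le_right _ _) h1)
    _ ≤ _ := by rw [one_smul]; gcongr

theorem IsCornerInverse.exists_smul_le {p m x : R} (h : IsCornerInverse p m x) (hm : 0 ≤ m) :
    ∃ c : ℝ, 0 < c ∧ c • p ≤ m := by
  have h1 := one_sub_nonneg_of_isProj h.star_eq h.proj_mul_proj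
  obtain ⟨c, hc, hle⟩ := exists_smul_one_le (add_nonneg hm h1) h.isUnit_add_compl
  refine ⟨c, hc, ?_⟩
  -- Compression by `p` removes the summand `1 - p` that was added to make `m` invertible.
  have h2 := star_left_conjugate_le_conjugate hle p
  rw [h.star_eq, mul_smul_comm, mul_one, smul_mul_assoc, h.proj_mul_proj, mul_add, h.proj_mul,
    mul_sub, mul_one, h.proj_mul_proj, sub_self, add_zero, h.mul_proj] at h2
  exact h2

end CornerAlgebra

end HilbertModuleCorners

/-! ### Moore–Penrose inverses: corners, inner inverses, complementary projection. -/

noncomputable section HilbertModuleMoorePenrose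

open scoped AdjOp

set_option linter.unusedSectionVars false

variable {𝔄 : Type*} [NonUnitalCStarAlgebra 𝔄] [PartialOrder 𝔄] [StarOrderedRing 𝔄]
  {H : Type*} [NormedAddCommGroup H] [NormedSpace ℂ H] [SMul 𝔄 H] [CStarModule 𝔄 H]
  {K : Type*} [NormedAddCommGroup K] [NormedSpace ℂ K] [SMul 𝔄 K] [CStarModule 𝔄 K]
  {E : Type*} [NormedAddCommGroup E] [NormedSpace ℂ E] [SMul 𝔄 E] [CStarModule 𝔄 E]

namespace AdjOp

theorem IsMPInverse.unique {T : AdjOp 𝔄 H K} {X Y : AdjOp 𝔄 K H} (hX : T.IsMPInverse X)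
    (hY : T.IsMPInverse Y) : X = Y := by
  have h1 : T ⬝ X = T ⬝ Y := by
    have h : T ⬝ X = (T ⬝ Y) ⬝ T ⬝ X := by
      change T ⬝ X = (T ⬝ Y ⬝ T) ⬝ X; rw [hY.mul_mul_self]
    have h' : (T ⬝ X) ⬝ T ⬝ Y = T ⬝ Y := by
      change (T ⬝ X ⬝ T) ⬝ Y = T ⬝ Y; rw [hX.mul_mul_self]
    rw [← hX.adj_left, h, adj_comp, hY.adj_left, hX.adj_left, h']
  have h2 : X ⬝ T = Y ⬝ T := by
    have h : X ⬝ T = (X ⬝ T) ⬝ Y ⬝ T := by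
      change X ⬝ T = X ⬝ (T ⬝ Y ⬝ T); rw [hY.mul_mul_self]
    have h' : (Y ⬝ T) ⬝ X ⬝ T = Y ⬝ T := by
      change Y ⬝ (T ⬝ X ⬝ T) = Y ⬝ T; rw [hX.mul_mul_self]
    rw [← hX.adj_right, h, adj_comp, hY.adj_right, hX.adj_right, h']
  calc X = X ⬝ T ⬝ X := hX.self_mul_mul.symm
    _ = (X ⬝ T) ⬝ Y := by rw [h1]; rfl
    _ = Y := by rw [h2]; exact hY.self_mul_mul

theorem MPInvertible.isMPInverse_mpInv {T : AdjOp 𝔄 H K} (h : T.MPInvertible) :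
    T.IsMPInverse T.mpInv := by
  rw [mpInv, dif_pos h]; exact h.choose_spec

theorem IsMPInverse.mpInv_eq {T : AdjOp 𝔄 H K} {X : AdjOp 𝔄 K H} (h : T.IsMPInverse X) :
    T.mpInv = X :=
  (MPInvertible.isMPInverse_mpInv ⟨X, h⟩).unique h

theorem _root_.IsCornerInverse.isMPInverse {p M X : AdjOp 𝔄 H H} (h : IsCornerInverse p M X) :
    M.IsMPInverse X where
  mul_mul_self := by
    change M * (X * M) = M; rw [h.inv_mul, h.mul_proj]
  self_mul_mul := by
    change X * (M * X) = X; rw [h.mul_inv, h.inv_mul_proj]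
  adj_left := by
    change star (M * X) = M * X; rw [h.mul_inv, h.star_eq]
  adj_right := by
    change star (X * M) = X * M; rw [h.inv_mul, h.star_eq]

theorem IsMPInverse.isCornerInverse {M X : AdjOp 𝔄 H H} (h : M.IsMPInverse X)
    (hM : M.adj = M) : IsCornerInverse (X ⬝ M) M X := by
  have hX : X.adj = X := by
    refine IsMPInverse.unique (T := M) ⟨?_, ?_, ?_, ?_⟩ h
    · simpa [hM, comp_assoc] using congrArg adj h.mul_mul_self
    · simpa [hM, comp_assoc] using congrArg adj h.self_mul_mul
    · simpa [hM] using congrArg adj h.adj_right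
    · simpa [hM] using congrArg adj h.adj_left
  have hc : M ⬝ X = X ⬝ M := by
    rw [← h.adj_left, adj_comp, hM, hX]
  exact ⟨h.adj_right, hc, rfl, (congrArg (· ⬝ M) hc.symm).trans h.mul_mul_self, h.self_mul_mul⟩

theorem invertible_iff_isUnit {T : AdjOp 𝔄 H H} : T.Invertible ↔ IsUnit T :=
  ⟨fun ⟨X, h1, h2⟩ => ⟨⟨T, X, h2, h1⟩, rfl⟩,
    fun ⟨u, hu⟩ => ⟨↑u⁻¹, by subst hu; exact ⟨u.inv_mul, u.mul_inv⟩⟩⟩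

theorem Invertible.isInverse_inverse {T : AdjOp 𝔄 H H} (h : T.Invertible) :
    T.IsInverse T.inverse := by
  rw [inverse, dif_pos h]; exact h.choose_spec

variable [CompleteSpace H] [CompleteSpace K]

theorem adj_comp_self_le_norm_smul (S : AdjOp 𝔄 H K) (X : AdjOp 𝔄 K H) :
    (X ⬝ S).adj ⬝ (X ⬝ S) ≤ ‖X.adj ⬝ X‖ • (S.adj ⬝ S) := by
  have h0 := adj_comp_self_nonneg X
  have h := conj_mono (h0.isSelfAdjoint.le_algebraMap_norm_self) S
  rw [Algebra.algebraMap_eq_smul_one, ← Complex.coe_smul, smul_comp, comp_smul,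
    Complex.coe_smul] at h
  rw [adj_comp]
  exact h

/-- With the idempotent `e = XT`, the element `z = T*T + (1 - e)*(1 - e)` is invertible because `e +
(1 - e) = 1`. Since `ze = T*T`, one gets `z⁻¹T*T = e`, so `Y = z⁻¹T*` works: `TY = T z⁻¹ T*` is
self-adjoint. -/
theorem exists_inner_inverse_adj_left {T : AdjOp 𝔄 H K} {X : AdjOp 𝔄 K H} (h : T ⬝ X ⬝ T = T) :
    ∃ Y : AdjOp 𝔄 K H, T ⬝ Y ⬝ T = T ∧ (T ⬝ Y).adj = T ⬝ Y := by
  set e : AdjOp 𝔄 H H := X ⬝ T with he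
  have hTe : T ⬝ e = T := h
  have hee : e * e = e := by
    change X ⬝ (T ⬝ X ⬝ T) = X ⬝ T; rw [h]
  set f : AdjOp 𝔄 H H := T.adj ⬝ T with hf
  have hfs : star f = f := by change f.adj = f; simp [hf]
  have hfe : f * e = f := by change T.adj ⬝ (T ⬝ e) = f; rw [hTe]
  have hu : IsUnit (f + star (1 - e) * (1 - e)) :=
    isUnit_add_of_add_eq_one (u := e) (v := 1 - e) (by abel) (adj_comp_self_nonneg T)
      (star_mul_self_nonneg _) (adj_comp_self_le_norm_smul T X) (one_smul ℝ _).ge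
  set z := f + star (1 - e) * (1 - e) with hz
  have hzs : star z = z := by rw [hz]; simp [hfs]
  have hze : z * e = f := by
    rw [hz, add_mul, hfe, mul_assoc, sub_mul, one_mul, hee, sub_self, mul_zero, add_zero]
  obtain ⟨u, hu⟩ := hu
  have hif : (↑u⁻¹ : AdjOp 𝔄 H H) * f = e := by
    rw [← hze, ← hu, ← mul_assoc, Units.inv_mul, one_mul]
  have his : star (↑u⁻¹ : AdjOp 𝔄 H H) = ↑u⁻¹ := by
    have : star u = u := Units.ext (by rw [Units.coe_star, hu, hzs])
    rw [← Units.coe_star_inv, this]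
  refine ⟨↑u⁻¹ ⬝ T.adj, ?_, ?_⟩
  · change T ⬝ ((↑u⁻¹ : AdjOp 𝔄 H H) * f) = T
    rw [hif, hTe]
  · rw [adj_comp, adj_comp, adj_adj, adj_eq_star, his]; rfl

/-- Take inner inverses `Y` of `T` and `Z` of `T*` with `TY` and `T*Z` self-adjoint; then `Z* T Y`
satisfies all four Penrose equations. -/
theorem mpInvertible_of_comp_comp_self {T : AdjOp 𝔄 H K} {X : AdjOp 𝔄 K H}
    (h : T ⬝ X ⬝ T = T) : T.MPInvertible := by
  obtain ⟨Y, hY, hYs⟩ := exists_inner_inverse_adj_left h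
  obtain ⟨Z, hZ, hZs⟩ := exists_inner_inverse_adj_left (T := T.adj) (X := X.adj)
    (by simpa [comp_assoc] using congrArg adj h)
  have hZ' : T ⬝ Z.adj ⬝ T = T := by simpa [comp_assoc] using congrArg adj hZ
  have hZs' : (Z.adj ⬝ T).adj = Z.adj ⬝ T := by simpa using hZs.symm
  have h1 : T ⬝ Z.adj ⬝ T ⬝ Y = T ⬝ Y := congrArg (· ⬝ Y) hZ'
  have h2 : (Z.adj ⬝ T ⬝ Y) ⬝ T = Z.adj ⬝ T := congrArg (Z.adj ⬝ ·) hY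
  refine ⟨Z.adj ⬝ T ⬝ Y, ?_, ?_, ?_, ?_⟩
  · rw [h2, hZ']
  · rw [h1]; exact congrArg (Z.adj ⬝ ·) (congrArg (· ⬝ Y) hY)
  · rw [h1, hYs]
  · rw [h2, hZs']

theorem PosDefinite.exists_smul_one_le {M : AdjOp 𝔄 H H} (hM : M.PosDefinite) :
    ∃ c : ℝ, 0 < c ∧ c • (1 : AdjOp 𝔄 H H) ≤ M := by
  obtain ⟨S, hS⟩ := hM.positive
  exact _root_.exists_smul_one_le (hS ▸ adj_comp_self_nonneg S)
    (invertible_iff_isUnit.1 hM.invertible)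

theorem isUnit_conj_add_compl {p : AdjOp 𝔄 H H} {S : AdjOp 𝔄 H K} {V : AdjOp 𝔄 K K}
    (hp : star p = p) (hpp : p * p = p) {c : ℝ} (hc : 0 < c)
    (hle : c • p ≤ S.adj ⬝ S) (hV : V.PosDefinite) : IsUnit (S.adj ⬝ V ⬝ S + (1 - p)) := by
  obtain ⟨d, hd, hdV⟩ := hV.exists_smul_one_le
  refine isUnit_add_compl_of_smul_le hp hpp (mul_pos hd hc) ?_
  have h := conj_mono hdV S
  rw [← Complex.coe_smul, smul_comp, comp_smul, Complex.coe_smul] at h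
  rw [mul_smul]
  exact (smul_le_smul_of_nonneg_left hle hd.le).trans h

theorem isCornerInverse_conj {p : AdjOp 𝔄 H H} {S : AdjOp 𝔄 H K} {V : AdjOp 𝔄 K K}
    (hp : star p = p) (hpp : p * p = p) (hSp : S ⬝ p = S) {c : ℝ} (hc : 0 < c)
    (hle : c • p ≤ S.adj ⬝ S) (hV : V.PosDefinite) :
    ∃ x, IsCornerInverse p (S.adj ⬝ V ⬝ S) x := by
  refine ⟨_, IsCornerInverse.of_isUnit hp hpp ?_ ?_ (isUnit_conj_add_compl hp hpp hc hle hV)⟩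
  · have : p ⬝ S.adj = S.adj := by simpa [adj_eq_star, hp] using congrArg adj hSp
    exact congrArg (· ⬝ V ⬝ S) this
  · exact congrArg (fun Z => S.adj ⬝ V ⬝ Z) hSp

theorem MPInvertible.exists_smul_le_adj_comp_self {A : AdjOp 𝔄 H K} (hA : A.MPInvertible) :
    ∃ c : ℝ, 0 < c ∧ c • (A.mpInv ⬝ A) ≤ A.adj ⬝ A := by
  have h := hA.isMPInverse_mpInv
  have h1 := adj_comp_self_le_norm_smul A A.mpInv
  have h2 : (A.mpInv ⬝ A).adj ⬝ (A.mpInv ⬝ A) = A.mpInv ⬝ A := by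
    rw [h.adj_right]; exact congrArg (A.mpInv ⬝ ·) h.mul_mul_self
  rw [h2] at h1
  have hc : 0 < ‖A.mpInv.adj ⬝ A.mpInv‖ + 1 := by positivity
  refine ⟨_, inv_pos.2 hc, ?_⟩
  rw [inv_smul_le_iff_of_pos hc]
  refine h1.trans (smul_le_smul_of_nonneg_right (by linarith) (adj_comp_self_nonneg A))

/-- The projection onto the orthogonal complement of `R(A*)` in the support of `A*A + B*B`, on
which `B*B` is bounded below. -/
theorem exists_complementary_projection {A : AdjOp 𝔄 H K} {B : AdjOp 𝔄 H E}
    (hA : A.MPInvertible) (hAB : (A.adj ⬝ A + B.adj ⬝ B).MPInvertible) [CompleteSpace E] :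
    ∃ R : AdjOp 𝔄 H H, star R = R ∧ R * R = R ∧ (A.mpInv ⬝ A) * R = 0 ∧ A ⬝ R = 0 ∧
      B ⬝ (A.mpInv ⬝ A + R) = B ∧ ∃ c : ℝ, 0 < c ∧ c • R ≤ (B ⬝ R).adj ⬝ (B ⬝ R) := by
  have hX := hA.isMPInverse_mpInv
  set D := A.adj ⬝ A + B.adj ⬝ B with hD
  have hD0 : 0 ≤ D := add_nonneg (adj_comp_self_nonneg A) (adj_comp_self_nonneg B)
  have hDp := hAB.isMPInverse_mpInv.isCornerInverse hD0.isSelfAdjoint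
  set p : AdjOp 𝔄 H H := D.mpInv ⬝ D with hp
  obtain ⟨c, hc, hle⟩ := hDp.exists_smul_le hD0
  have hD' : ∀ S : AdjOp 𝔄 H H, (A ⬝ S).adj ⬝ (A ⬝ S) + (B ⬝ S).adj ⬝ (B ⬝ S) =
      star S * D * S := fun S => by
    change _ = S.adj ⬝ D ⬝ S
    simp only [hD, adj_comp, comp_assoc, add_comp, comp_add]
  -- A vanishing sum of two squares makes both `A` and `B` vanish on `1 - p`.
  have hsum : (A ⬝ (1 - p)).adj ⬝ (A ⬝ (1 - p)) + (B ⬝ (1 - p)).adj ⬝ (B ⬝ (1 - p)) = 0 := by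
    rw [hD', mul_assoc, mul_sub, mul_one, hDp.mul_proj, sub_self, mul_zero]
  have hBp : B ⬝ p = B := by
    have := adj_comp_self_add_eq_zero hsum
    rw [comp_sub, sub_eq_zero] at this
    exact this.symm
  have hAp : A ⬝ p = A := by
    have := adj_comp_self_add_eq_zero (by rwa [add_comm] at hsum)
    rw [comp_sub, sub_eq_zero] at this
    exact this.symm
  set P : AdjOp 𝔄 H H := A.mpInv ⬝ A with hP
  have hPs : star P = P := hX.adj_right
  have hPp : P * p = P := congrArg (A.mpInv ⬝ ·) hAp
  have hpP : p * P = P := by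
    have := congrArg star hPp
    rwa [star_mul, hPs, hDp.star_eq] at this
  have hAP : A ⬝ P = A := hX.mul_mul_self
  have hPP : P * P = P := congrArg (A.mpInv ⬝ ·) hAP
  have hAR : A ⬝ (p - P) = 0 := by rw [comp_sub, hAp, hAP, sub_self]
  have hRs : star (p - P) = p - P := by rw [star_sub, hPs, hDp.star_eq]
  have hRR : (p - P) * (p - P) = p - P := by
    rw [mul_sub, sub_mul, sub_mul, hDp.proj_mul_proj, hPp, hpP, hPP]; abel
  refine ⟨p - P, hRs, hRR, ?_, hAR, ?_, c, hc, ?_⟩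
  · rw [mul_sub, hPp, hPP, sub_self]
  · rw [add_sub_cancel, hBp]
  -- In `c p ≤ A*A + B*B` compressed to `R = p - P`, the term from `A` drops out because `AR = 0`.
  · have h1 := star_left_conjugate_le_conjugate hle (p - P)
    rw [← hD', hAR, mul_smul_comm, smul_mul_assoc, hRs] at h1
    have h2 : (p - P) * p * (p - P) = p - P := by
      rw [sub_mul p P p, hDp.proj_mul_proj, hPp, hRR]
    rw [h2] at h1
    simpa using h1

end AdjOp

end HilbertModuleMoorePenrose

/-! ### The oblique idempotent `F = G B*WB` and the decomposition of `B`. -/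

noncomputable section HilbertModuleDecomposition

open scoped AdjOp

set_option linter.unusedSectionVars false

variable {𝔄 : Type*} [NonUnitalCStarAlgebra 𝔄] [PartialOrder 𝔄] [StarOrderedRing 𝔄]
  {H : Type*} [NormedAddCommGroup H] [NormedSpace ℂ H] [SMul 𝔄 H] [CStarModule 𝔄 H]
  {K : Type*} [NormedAddCommGroup K] [NormedSpace ℂ K] [SMul 𝔄 K] [CStarModule 𝔄 K]
  {E : Type*} [NormedAddCommGroup E] [NormedSpace ℂ E] [SMul 𝔄 E] [CStarModule 𝔄 E]

/-- `P` is the projection onto `R(A*)`, `R` a projection orthogonal to it such that `B` lives on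
`P + R`, and `G` is the inverse of `R B* W B R` in the corner of `R`. -/
structure IsComplementaryCorner (A : AdjOp 𝔄 H K) (B : AdjOp 𝔄 H E) (W : AdjOp 𝔄 E E)
    (X : AdjOp 𝔄 K H) (R G : AdjOp 𝔄 H H) : Prop where
  star_proj : star (X ⬝ A) = X ⬝ A
  comp_proj : A ⬝ X ⬝ A = A
  proj_mul : (X ⬝ A) * R = 0
  comp_compl : A ⬝ R = 0
  comp_add : B ⬝ (X ⬝ A + R) = B
  corner : IsCornerInverse R ((B ⬝ R).adj ⬝ W ⬝ B ⬝ R) G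
  selfAdjoint : W.adj = W

namespace IsComplementaryCorner

open AdjOp

variable {A : AdjOp 𝔄 H K} {B : AdjOp 𝔄 H E} {W : AdjOp 𝔄 E E} {X : AdjOp 𝔄 K H}
  {R G : AdjOp 𝔄 H H} (h : IsComplementaryCorner A B W X R G)

include h

theorem star_compl : star R = R := h.corner.star_eq

theorem proj_mul_proj : (X ⬝ A) * (X ⬝ A) = X ⬝ A := congrArg (X ⬝ ·) h.comp_proj

theorem compl_mul : R * (X ⬝ A) = 0 := by
  rw [← h.star_compl, ← h.star_proj, ← star_mul, h.proj_mul, star_zero]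

theorem proj_comp_adj : (X ⬝ A) ⬝ A.adj = A.adj := by
  have := congrArg adj h.comp_proj
  rwa [adj_comp, adj_eq_star (X ⬝ A), h.star_proj] at this

theorem proj_eq : A.adj ⬝ X.adj = X ⬝ A := by
  rw [← adj_comp]; exact h.star_proj

theorem star_inv : star G = G :=
  h.corner.star_inv (by
    change adj _ = _
    simp [h.selfAdjoint, comp_assoc])

/-- The oblique projection `G B* W B` along the kernel of the orthogonal part of `B`. -/
theorem oblique_mul_compl : (G ⬝ B.adj ⬝ W ⬝ B) * R = R := by
  have h1 : G ⬝ R ⬝ B.adj ⬝ W ⬝ B ⬝ R = R := by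
    have := h.corner.inv_mul
    rw [adj_comp, adj_eq_star R, h.star_compl] at this
    exact this
  have h2 : G ⬝ R = G := h.corner.inv_mul_proj
  calc _ = (G ⬝ R) ⬝ B.adj ⬝ W ⬝ B ⬝ R := by rw [h2]; rfl
    _ = R := h1

theorem compl_mul_oblique : R * (G ⬝ B.adj ⬝ W ⬝ B) = G ⬝ B.adj ⬝ W ⬝ B :=
  congrArg (· ⬝ B.adj ⬝ W ⬝ B) h.corner.proj_mul_inv

theorem oblique_mul_oblique : (G ⬝ B.adj ⬝ W ⬝ B) * (G ⬝ B.adj ⬝ W ⬝ B) =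
    G ⬝ B.adj ⬝ W ⬝ B := by
  have h1 := h.oblique_mul_compl
  have h2 := h.compl_mul_oblique
  generalize G ⬝ B.adj ⬝ W ⬝ B = F at *
  nth_rw 2 [← h2]
  rw [← mul_assoc, h1, h2]

theorem oblique_mul_add : (G ⬝ B.adj ⬝ W ⬝ B) * (X ⬝ A + R) = G ⬝ B.adj ⬝ W ⬝ B :=
  congrArg (G ⬝ B.adj ⬝ W ⬝ ·) h.comp_add

theorem proj_mul_oblique : (X ⬝ A) * (G ⬝ B.adj ⬝ W ⬝ B) = 0 := by
  rw [← h.compl_mul_oblique, ← mul_assoc, h.proj_mul, zero_mul]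

theorem comp_oblique : A ⬝ (G ⬝ B.adj ⬝ W ⬝ B) = 0 := by
  rw [← h.compl_mul_oblique]
  change (A ⬝ R) ⬝ (G ⬝ B.adj ⬝ W ⬝ B) = 0
  rw [h.comp_compl, zero_comp]

theorem star_oblique : (G ⬝ B.adj ⬝ W ⬝ B).adj = B.adj ⬝ W ⬝ B ⬝ G := by
  simp [h.selfAdjoint, comp_assoc, adj_eq_star G, h.star_inv]

theorem sub_comp_oblique_comp_proj :
    (B - B ⬝ (G ⬝ B.adj ⬝ W ⬝ B)) ⬝ (X ⬝ A) = B - B ⬝ (G ⬝ B.adj ⬝ W ⬝ B) := by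
  have h1 : (B - B ⬝ (G ⬝ B.adj ⬝ W ⬝ B)) ⬝ R = 0 := by
    rw [sub_comp, sub_eq_zero]
    exact (congrArg (B ⬝ ·) h.oblique_mul_compl).symm
  have h2 : (B - B ⬝ (G ⬝ B.adj ⬝ W ⬝ B)) ⬝ (X ⬝ A + R) = B - B ⬝ (G ⬝ B.adj ⬝ W ⬝ B) := by
    rw [sub_comp, h.comp_add]
    exact congrArg (B - B ⬝ ·) h.oblique_mul_add
  rwa [AdjOp.comp_add, h1, add_zero] at h2

theorem comp_proj_of_range_le {C : AdjOp 𝔄 H E} (hC : C.adj.ran ≤ A.adj.ran) :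
    C ⬝ (X ⬝ A) = C := by
  have h1 : (X ⬝ A) ⬝ C.adj = C.adj := by
    refine ext_apply fun y => ?_
    obtain ⟨z, hz⟩ := hC ⟨y, rfl⟩
    change (X ⬝ A).1 (C.adj.1 y) = C.adj.1 y
    have hz' : A.adj.1 z = C.adj.1 y := hz
    rw [← hz']
    exact congrArg (fun Z => Z.1 z) h.proj_comp_adj
  simpa [adj_eq_star (X ⬝ A), h.star_proj] using congrArg adj h1

theorem isSeparatedDecomposition : IsSeparatedDecomposition A B W
    (B - B ⬝ (G ⬝ B.adj ⬝ W ⬝ B)) (B ⬝ (G ⬝ B.adj ⬝ W ⬝ B)) where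
  eq_add := by abel
  orthogonal := by
    rw [adj_comp, h.star_oblique, AdjOp.comp_sub, AdjOp.comp_sub, sub_eq_zero]
    exact (congrArg (fun Z => B.adj ⬝ W ⬝ B ⬝ Z) h.oblique_mul_oblique).symm
  range_le := by
    rintro _ ⟨y, rfl⟩
    have h1 := congrArg adj h.sub_comp_oblique_comp_proj
    rw [adj_comp, ← h.proj_eq, adj_comp, adj_adj, adj_adj, h.proj_eq.symm] at h1
    rw [← h1]
    exact ⟨_, rfl⟩
  separated := by
    set F := G ⬝ B.adj ⬝ W ⬝ B with hF
    have hRFs : R * star F = R := by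
      have := congrArg star h.oblique_mul_compl
      rwa [star_mul, h.star_compl] at this
    have hFsR : star F * R = star F := by
      have := congrArg star h.compl_mul_oblique
      rwa [star_mul, h.star_compl] at this
    constructor
    · rw [eq_bot_iff]
      rintro y ⟨⟨z, hz⟩, ⟨w, hw⟩⟩
      have hPy : (X ⬝ A).1 y = y := by
        rw [← hz]; exact congrArg (fun Z => Z.1 z) h.proj_comp_adj
      have hRy : R.1 y = 0 := by
        rw [← hPy]; exact congrArg (fun Z => Z.1 y) h.compl_mul
      have hw' : (star F).1 (B.adj.1 w) = y := by
        rw [← hw, adj_comp]; rfl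
      have h1 : R.1 (B.adj.1 w) = 0 := by
        rw [← hRy, ← hw']; exact (congrArg (fun Z => Z.1 (B.adj.1 w)) hRFs).symm
      have h2 : y = (star F).1 (R.1 (B.adj.1 w)) := by
        rw [← hw']; exact (congrArg (fun Z => Z.1 (B.adj.1 w)) hFsR).symm
      rw [h1, map_zero] at h2
      exact h2
    · have hpA : (X ⬝ A + R) ⬝ A.adj = A.adj := by
        have : R ⬝ A.adj = 0 := by
          simpa [adj_eq_star R, h.star_compl] using congrArg adj h.comp_compl
        rw [add_comp, h.proj_comp_adj, this, add_zero]
      have hpF : (X ⬝ A + R) * star F = star F := by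
        have := congrArg star h.oblique_mul_add
        rwa [star_mul, star_add, h.star_proj, h.star_compl] at this
      have hFran (x : H) : (star F).1 x ∈ (B ⬝ F).adj.ran := by
        refine ⟨(W ⬝ B ⬝ G).1 x, ?_⟩
        -- Idempotence gives `F* = F*F* = F*B*(WBG)`, so `F*` factors through `B₂* = F*B*`.
        have h1 : star F = (B ⬝ F).adj ⬝ W ⬝ B ⬝ G := by
          have := congrArg star h.oblique_mul_oblique
          rw [star_mul] at this
          rw [adj_comp]
          conv_lhs => rw [← this]
          exact congrArg (F.adj * ·) h.star_oblique
        rw [h1]; rfl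
      -- The sum is the fixed-point set of `P + R`, hence closed. For the harder inclusion, `F* =
      -- PF* + R` gives `P + R = P(1 - F*) + F*`.
      have hset : ((A.adj.ran ⊔ (B ⬝ F).adj.ran : Submodule ℂ H) : Set H) =
          {x | (X ⬝ A + R).1 x = x} := by
        refine Set.Subset.antisymm ?_ ?_
        · have hle : A.adj.ran ⊔ (B ⬝ F).adj.ran ≤
              LinearMap.eqLocus ((X ⬝ A + R).1 : H →ₗ[ℂ] H) LinearMap.id := by
            refine sup_le ?_ ?_
            · rintro _ ⟨y, rfl⟩
              exact congrArg (fun Z => Z.1 y) hpA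
            · rintro _ ⟨y, rfl⟩
              rw [adj_comp]
              exact congrArg (fun Z => Z.1 (B.adj.1 y)) hpF
          exact hle
        · intro x hx
          have hPF : X ⬝ A + R = (X ⬝ A) - (X ⬝ A) * star F + star F := by
            have e : star F = (X ⬝ A) * star F + R := by
              rwa [add_mul, hRFs, eq_comm] at hpF
            rw [sub_add, sub_eq_add_neg, neg_sub, add_right_inj]
            exact (sub_eq_of_eq_add' e).symm
          have hPran (y : H) : (X ⬝ A).1 y ∈ A.adj.ran := by
            rw [← h.proj_eq]; exact ⟨_, rfl⟩
          have hx' : (X ⬝ A + R).1 x = x := hx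
          rw [← hx', hPF]
          exact Submodule.add_mem_sup (sub_mem (hPran _) (hPran ((star F).1 x))) (hFran x)
      rw [hset]
      exact isClosed_eq (X ⬝ A + R).1.continuous continuous_id

/-- The difference `C = B₂ - BF` lives on `P`, so `C*` has range in `R(A*)`. Orthogonality gives `F
= GB*WB₂`, so `C*` also has range in `R(B₂*)`. Trivial intersection forces `C = 0`. -/
theorem eq_of_isSeparatedDecomposition {B₁ B₂ : AdjOp 𝔄 H E}
    (hd : IsSeparatedDecomposition A B W B₁ B₂) : B₂ = B ⬝ (G ⬝ B.adj ⬝ W ⬝ B) := by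
  have h1 := h.comp_proj_of_range_le hd.range_le
  have h1R : B₁ ⬝ R = 0 := by
    rw [← h1]; exact (congrArg (B₁ ⬝ ·) h.proj_mul).trans (comp_zero _)
  have h2R : B₂ ⬝ R = B ⬝ R := by rw [hd.eq_add, add_comp, h1R, zero_add]
  have hRB : R ⬝ B₂.adj = R ⬝ B.adj := by
    simpa [adj_eq_star R, h.star_compl] using congrArg adj h2R
  have hGB : G ⬝ B.adj ⬝ W ⬝ B₁ = 0 := by
    have e1 : R ⬝ B.adj ⬝ W ⬝ B₁ = 0 := by
      -- On `R` the operators `B` and `B₂` agree, so the orthogonality of `B₂` passes to `B`.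
      calc R ⬝ B.adj ⬝ W ⬝ B₁ = (R ⬝ B.adj) ⬝ W ⬝ B₁ := rfl
        _ = R ⬝ B₂.adj ⬝ W ⬝ B₁ := by rw [← hRB]; rfl
        _ = 0 := by rw [hd.orthogonal, comp_zero]
    have e2 : G ⬝ R = G := h.corner.inv_mul_proj
    calc G ⬝ B.adj ⬝ W ⬝ B₁ = (G ⬝ R) ⬝ B.adj ⬝ W ⬝ B₁ := by rw [e2]
      _ = G ⬝ R ⬝ B.adj ⬝ W ⬝ B₁ := rfl
      _ = 0 := by rw [e1, comp_zero]
  have hF : G ⬝ B.adj ⬝ W ⬝ B = G ⬝ B.adj ⬝ W ⬝ B₂ := by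
    nth_rw 2 [hd.eq_add]
    rw [AdjOp.comp_add, AdjOp.comp_add, AdjOp.comp_add, hGB, zero_add]
  set C := B₂ - B ⬝ (G ⬝ B.adj ⬝ W ⬝ B) with hC
  have hCR : C ⬝ R = 0 := by
    rw [hC, sub_comp, h2R, sub_eq_zero]
    exact (congrArg (B ⬝ ·) h.oblique_mul_compl).symm
  have hCp : C ⬝ (X ⬝ A) = C := by
    have e1 : B₁ ⬝ (X ⬝ A + R) = B₁ := by rw [AdjOp.comp_add, h1, h1R, add_zero]
    have e2 : B₂ ⬝ (X ⬝ A + R) = B₂ := by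
      have := h.comp_add
      rwa [hd.eq_add, add_comp, e1, add_right_inj] at this
    have e3 : C ⬝ (X ⬝ A + R) = C := by
      rw [hC, sub_comp, e2]
      exact congrArg (B₂ - B ⬝ ·) h.oblique_mul_add
    rwa [AdjOp.comp_add, hCR, add_zero] at e3
  have hC' : C.adj = B₂.adj ⬝ (idOp 𝔄 E - W ⬝ B ⬝ G ⬝ B.adj) := by
    rw [hC, hF]
    simp [AdjOp.comp_sub, h.selfAdjoint, comp_assoc, adj_eq_star G, h.star_inv]
  have hC0 : C.adj = 0 := by
    refine ext_apply fun y => ?_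
    have m1 : C.adj.1 y ∈ A.adj.ran := by
      have := congrArg adj hCp
      rw [adj_comp, adj_eq_star (X ⬝ A), h.star_proj, ← h.proj_eq] at this
      rw [← this]; exact ⟨_, rfl⟩
    have m2 : C.adj.1 y ∈ B₂.adj.ran := by
      rw [hC']; exact ⟨_, rfl⟩
    have : C.adj.1 y ∈ A.adj.ran ⊓ B₂.adj.ran := ⟨m1, m2⟩
    rw [hd.separated.1] at this
    exact this
  have : C = 0 := by rw [← adj_adj C, hC0, adj_zero]
  rwa [hC, sub_eq_zero] at this

theorem comp_inner_inverse_comp :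
    (B ⬝ (G ⬝ B.adj ⬝ W ⬝ B)) ⬝ (G ⬝ B.adj ⬝ W) ⬝ (B ⬝ (G ⬝ B.adj ⬝ W ⬝ B)) =
      B ⬝ (G ⬝ B.adj ⬝ W ⬝ B) := by
  have h1 := h.oblique_mul_oblique
  set F := G ⬝ B.adj ⬝ W ⬝ B with hF
  change B ⬝ (F * (F * F)) = B ⬝ F
  rw [h1, h1]

/-- The Moore–Penrose inverse of a positive combination, block-diagonalised by `P + F`. -/
theorem isCornerInverse_add {m x m' x' : AdjOp 𝔄 H H}
    (hm : IsCornerInverse (X ⬝ A) m x) (hm' : IsCornerInverse R m' x') :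
    IsCornerInverse (X ⬝ A + R)
      (star (X ⬝ A + G ⬝ B.adj ⬝ W ⬝ B) * (m + m') * (X ⬝ A + G ⬝ B.adj ⬝ W ⬝ B))
      ((X ⬝ A + R - (G ⬝ B.adj ⬝ W ⬝ B) * (X ⬝ A)) * (x + x') *
        star (X ⬝ A + R - (G ⬝ B.adj ⬝ W ⬝ B) * (X ⬝ A))) := by
  have h1 := hm.unipotent_conj hm' h.proj_mul
    (n := (G ⬝ B.adj ⬝ W ⬝ B) * (X ⬝ A))
    (by rw [← mul_assoc, h.compl_mul_oblique]) (by rw [mul_assoc, h.proj_mul_proj])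
  have h2 : X ⬝ A + R + (G ⬝ B.adj ⬝ W ⬝ B) * (X ⬝ A) = X ⬝ A + G ⬝ B.adj ⬝ W ⬝ B := by
    have := h.oblique_mul_add
    rw [mul_add, h.oblique_mul_compl] at this
    rw [add_assoc, add_comm R, this]
  rwa [h2] at h1

theorem conj_eq {m : AdjOp 𝔄 H H} (W' : AdjOp 𝔄 E E)
    (hm : star (X ⬝ A + G ⬝ B.adj ⬝ W ⬝ B) * m * (X ⬝ A + G ⬝ B.adj ⬝ W ⬝ B) = m) :
    star (X ⬝ A + G ⬝ B.adj ⬝ W ⬝ B) * (m + (B ⬝ R).adj ⬝ W' ⬝ B ⬝ R) *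
      (X ⬝ A + G ⬝ B.adj ⬝ W ⬝ B) =
    m + (B ⬝ (G ⬝ B.adj ⬝ W ⬝ B)).adj ⬝ W' ⬝ B ⬝ (G ⬝ B.adj ⬝ W ⬝ B) := by
  have h1 : R * (X ⬝ A + G ⬝ B.adj ⬝ W ⬝ B) = G ⬝ B.adj ⬝ W ⬝ B := by
    rw [mul_add, h.compl_mul, h.compl_mul_oblique, zero_add]
  generalize X ⬝ A + G ⬝ B.adj ⬝ W ⬝ B = L at *
  rw [mul_add, add_mul, hm, ← h1]
  congr 1
  change _ = (B ⬝ (R ⬝ L)).adj ⬝ W' ⬝ B ⬝ (R ⬝ L)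
  simp only [adj_comp]
  rfl

theorem comp_block : A ⬝ (X ⬝ A + G ⬝ B.adj ⬝ W ⬝ B) = A := by
  rw [AdjOp.comp_add, h.comp_proj, h.comp_oblique, add_zero]

theorem conj_self (V : AdjOp 𝔄 K K) : star (X ⬝ A + G ⬝ B.adj ⬝ W ⬝ B) * (A.adj ⬝ V ⬝ A) *
    (X ⬝ A + G ⬝ B.adj ⬝ W ⬝ B) = A.adj ⬝ V ⬝ A := by
  have h1 := h.comp_block
  generalize X ⬝ A + G ⬝ B.adj ⬝ W ⬝ B = L at *
  calc _ = (A ⬝ L).adj ⬝ V ⬝ (A ⬝ L) := by rw [adj_comp]; rfl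
    _ = _ := by rw [h1]

/-- The off-diagonal and complementary blocks contribute `-F` after multiplying by `A*`. -/
theorem inverse_comp_adj {m x m' x' : AdjOp 𝔄 H H}
    (hm : IsCornerInverse (X ⬝ A) m x) (hm' : IsCornerInverse R m' x') (V : AdjOp 𝔄 K K) :
    ((X ⬝ A + R - (G ⬝ B.adj ⬝ W ⬝ B) * (X ⬝ A)) * (x + x') *
        star (X ⬝ A + R - (G ⬝ B.adj ⬝ W ⬝ B) * (X ⬝ A))) ⬝ A.adj ⬝ V =
      x ⬝ A.adj ⬝ V - (G ⬝ B.adj ⬝ W ⬝ B) ⬝ x ⬝ A.adj ⬝ V := by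
  have hA1 : A ⬝ (X ⬝ A + R - (G ⬝ B.adj ⬝ W ⬝ B) * (X ⬝ A)) = A := by
    have e : A ⬝ ((G ⬝ B.adj ⬝ W ⬝ B) * (X ⬝ A)) = 0 := by
      change (A ⬝ (G ⬝ B.adj ⬝ W ⬝ B)) ⬝ (X ⬝ A) = 0
      rw [h.comp_oblique, zero_comp]
    rw [AdjOp.comp_sub, AdjOp.comp_add, h.comp_proj, h.comp_compl, e, add_zero, sub_zero]
  have hA2 : star (X ⬝ A + R - (G ⬝ B.adj ⬝ W ⬝ B) * (X ⬝ A)) ⬝ A.adj = A.adj := by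
    rw [← adj_eq_star, ← adj_comp, hA1]
  have hRA : R ⬝ A.adj = 0 := by
    simpa [adj_eq_star R, h.star_compl] using congrArg adj h.comp_compl
  have hx' : x' ⬝ A.adj = 0 := by
    have e : x' ⬝ R = x' := hm'.inv_mul_proj
    rw [← e, comp_assoc, hRA, comp_zero]
  have hpx : (X ⬝ A + R - (G ⬝ B.adj ⬝ W ⬝ B) * (X ⬝ A)) * x =
      x - (G ⬝ B.adj ⬝ W ⬝ B) * x := by
    have e : R * x = 0 := by rw [← hm.proj_mul_inv, ← mul_assoc, h.compl_mul, zero_mul]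
    rw [sub_mul, add_mul, hm.proj_mul_inv, e, mul_assoc, hm.proj_mul_inv, add_zero]
  generalize X ⬝ A + R - (G ⬝ B.adj ⬝ W ⬝ B) * (X ⬝ A) = L at *
  calc _ = L ⬝ (x + x') ⬝ (star L ⬝ A.adj) ⬝ V := rfl
    _ = L ⬝ (x ⬝ A.adj + x' ⬝ A.adj) ⬝ V := by rw [hA2]; rfl
    _ = (L * x) ⬝ A.adj ⬝ V := by rw [hx', add_zero]; rfl
    _ = _ := by rw [hpx]; rfl

/-! ### The gap operator `2 - P - P₂`. -/

section Gap

variable {P₂ : AdjOp 𝔄 H H}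

theorem isUnit_gap [CompleteSpace H] (hs : star P₂ = P₂) (hP₂ : P₂ * P₂ = P₂)
    (hN : P₂ * (X ⬝ A - (G ⬝ B.adj ⬝ W ⬝ B) * (X ⬝ A)) = 0) :
    IsUnit ((2 : ℂ) • (1 : AdjOp 𝔄 H H) - X ⬝ A - P₂) := by
  have hP := h.proj_mul_proj
  have hPs := h.star_proj
  have hPN := h.proj_mul_oblique
  generalize X ⬝ A = P at *
  generalize G ⬝ B.adj ⬝ W ⬝ B = F at *
  have e1 : star (F * P) * P = 0 := by
    have : P * (F * P) = 0 := by rw [← mul_assoc, hPN, zero_mul]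
    have := congrArg star this
    rwa [star_mul, hPs, star_zero] at this
  have e2 : (P - star (F * P)) * P₂ = 0 := by
    have := congrArg star hN
    rwa [star_mul, star_sub, hPs, hs, star_zero] at this
  -- `P - FP` maps into the kernel of `P₂`; its adjoint therefore supplies the second coefficient,
  -- and `1` lies in the left ideal generated by `1 - P` and `1 - P₂`.
  have hsum : (1 + star (F * P)) * (1 - P) + (P - star (F * P)) * (1 - P₂) = 1 := by
    rw [mul_sub (P - star (F * P)), e2, mul_sub, add_mul 1 _ P, e1]
    noncomm_ring
  have hb {a q : AdjOp 𝔄 H H} : star (a * q) * (a * q) ≤ ‖star a * a‖ • (star q * q) := by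
    have := CStarAlgebra.star_left_conjugate_le_norm_smul (a := q) (b := star a * a)
    simpa only [star_mul, mul_assoc] using this
  have hq {q : AdjOp 𝔄 H H} (h1 : star q = q) (h2 : q * q = q) :
      star (1 - q) * (1 - q) = 1 - q := by
    rw [star_sub, star_one, h1, mul_sub, sub_mul, mul_one, sub_mul, h2]; simp
  have hu := isUnit_add_of_add_eq_one hsum (star_mul_self_nonneg (1 - P))
    (star_mul_self_nonneg (1 - P₂)) hb hb
  rw [hq hPs hP, hq hs hP₂] at hu
  convert hu using 1
  rw [two_smul]; abel

/-- Split `1 - P` into `R` and `1 - P - R`. Since `F(2 - P - P₂) = F - FP = R`, one has `RS = F`.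
The other part multiplies the gap operator to `2(1 - P - R)`, so it contributes a multiple of `(1 -
P - R)P = 0`. -/
theorem compl_mul_inverse_gap {S : AdjOp 𝔄 H H} (hF : (G ⬝ B.adj ⬝ W ⬝ B) * P₂ = G ⬝ B.adj ⬝ W ⬝ B)
    (hp : (X ⬝ A + R) * P₂ = P₂)
    (hS : ((2 : ℂ) • (1 : AdjOp 𝔄 H H) - X ⬝ A - P₂) * S = 1) :
    (1 - X ⬝ A) * S * (X ⬝ A) = (G ⬝ B.adj ⬝ W ⬝ B) * (X ⬝ A) := by
  have hPP := h.proj_mul_proj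
  have hRP := h.compl_mul
  have hFp := h.oblique_mul_add
  have hFR := h.oblique_mul_compl
  generalize X ⬝ A = P at *
  generalize G ⬝ B.adj ⬝ W ⬝ B = F at *
  rw [two_smul] at hS
  rw [mul_add, hFR] at hFp
  have h1 : R * S = F := by
    have e : F * (1 + 1 - P - P₂) = R := by
      rw [mul_sub, mul_sub, mul_add, mul_one, hF, ← sub_eq_of_eq_add' hFp.symm]; abel
    rw [← e, mul_assoc, hS, mul_one]
  have h2 : (1 - P - R) * S * P = 0 := by
    have e : (1 - P - R) * (1 + 1 - P - P₂) = (1 - P - R) + (1 - P - R) := by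
      have e1 : (1 - P - R) * P = 0 := by
        rw [sub_mul, sub_mul, one_mul, hPP, hRP]; simp
      have e2 : (1 - P - R) * P₂ = 0 := by
        rw [sub_sub, sub_mul, hp, one_mul, sub_self]
      rw [mul_sub, mul_sub, e1, e2, mul_add, mul_one]; simp
    have e3 : (1 - P - R) * S * P + (1 - P - R) * S * P = 0 := by
      rw [← add_mul, ← add_mul, ← e, mul_assoc _ _ S, hS, mul_one, sub_mul, sub_mul, one_mul,
        hPP, hRP]; simp
    rw [← two_smul ℂ] at e3
    exact (smul_eq_zero.1 e3).resolve_left two_ne_zero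
  have h3 : (1 - P) * S * P = (1 - P - R) * S * P + R * S * P := by noncomm_ring
  rw [h3, h2, h1, zero_add]

end Gap

end IsComplementaryCorner

end HilbertModuleDecomposition

/-! ### Block-diagonalisation of the weighted sum, the limit and its closed form. -/

noncomputable section HilbertModuleLimit

open scoped AdjOp

set_option linter.unusedSectionVars false

variable {𝔄 : Type*} [NonUnitalCStarAlgebra 𝔄] [PartialOrder 𝔄] [StarOrderedRing 𝔄]
  {H : Type*} [NormedAddCommGroup H] [NormedSpace ℂ H] [SMul 𝔄 H] [CStarModule 𝔄 H]
  {K : Type*} [NormedAddCommGroup K] [NormedSpace ℂ K] [SMul 𝔄 K] [CStarModule 𝔄 K]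
  {E : Type*} [NormedAddCommGroup E] [NormedSpace ℂ E] [SMul 𝔄 E] [CStarModule 𝔄 E]

namespace AdjOp

theorem continuous_comp_right (S : AdjOp 𝔄 H K) :
    Continuous fun T : AdjOp 𝔄 K E => T ⬝ S :=
  Continuous.subtype_mk (continuous_subtype_val.clm_comp continuous_const) _

theorem continuous_comp_left (T : AdjOp 𝔄 K E) :
    Continuous fun S : AdjOp 𝔄 H K => T ⬝ S :=
  Continuous.subtype_mk (continuous_const.clm_comp continuous_subtype_val) _

end AdjOp

theorem IsCornerInverse.smul {R : Type*} [Ring R] [StarRing R] [Algebra ℂ R] {p m x : R}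
    (h : IsCornerInverse p m x) {c : ℂ} (hc : c ≠ 0) : IsCornerInverse p (c • m) (c⁻¹ • x) where
  star_eq := h.star_eq
  mul_inv := by rw [smul_mul_smul_comm, mul_inv_cancel₀ hc, one_smul, h.mul_inv]
  inv_mul := by rw [smul_mul_smul_comm, inv_mul_cancel₀ hc, one_smul, h.inv_mul]
  proj_mul := by rw [mul_smul_comm, h.proj_mul]
  proj_mul_inv := by rw [mul_smul_comm, h.proj_mul_inv]

namespace IsComplementaryCorner

open AdjOp

variable {A : AdjOp 𝔄 H K} {B : AdjOp 𝔄 H E} {W : AdjOp 𝔄 E E} {X : AdjOp 𝔄 K H}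
  {R G : AdjOp 𝔄 H H} (h : IsComplementaryCorner A B W X R G)

include h

theorem conj_weighted_sum (c : ℂ) (V : AdjOp 𝔄 K K) {B₁ : AdjOp 𝔄 H E}
    (hB₁ : B₁ = B - B ⬝ (G ⬝ B.adj ⬝ W ⬝ B)) :
    star (X ⬝ A + G ⬝ B.adj ⬝ W ⬝ B) *
      ((A.adj ⬝ V ⬝ A + c • (B₁.adj ⬝ W ⬝ B₁)) + c • ((B ⬝ R).adj ⬝ W ⬝ B ⬝ R)) *
      (X ⬝ A + G ⬝ B.adj ⬝ W ⬝ B) = A.adj ⬝ V ⬝ A + c • (B.adj ⬝ W ⬝ B) := by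
  have h1 : B₁ ⬝ (X ⬝ A + G ⬝ B.adj ⬝ W ⬝ B) = B₁ := by
    have e1 : B₁ ⬝ (X ⬝ A) = B₁ := by rw [hB₁, h.sub_comp_oblique_comp_proj]
    have e2 : B₁ ⬝ (G ⬝ B.adj ⬝ W ⬝ B) = 0 := by
      rw [hB₁, sub_comp, sub_eq_zero]
      exact (congrArg (B ⬝ ·) h.oblique_mul_oblique).symm
    rw [AdjOp.comp_add, e1, e2, add_zero]
  have h2 : star (X ⬝ A + G ⬝ B.adj ⬝ W ⬝ B) * (B₁.adj ⬝ W ⬝ B₁) *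
      (X ⬝ A + G ⬝ B.adj ⬝ W ⬝ B) = B₁.adj ⬝ W ⬝ B₁ := by
    generalize X ⬝ A + G ⬝ B.adj ⬝ W ⬝ B = L at *
    calc _ = (B₁ ⬝ L).adj ⬝ W ⬝ (B₁ ⬝ L) := by rw [adj_comp]; rfl
      _ = _ := by rw [h1]
  have hd := h.isSeparatedDecomposition
  rw [← hB₁] at hd
  have h3 : B.adj ⬝ W ⬝ B = B₁.adj ⬝ W ⬝ B₁ +
      (B ⬝ (G ⬝ B.adj ⬝ W ⬝ B)).adj ⬝ W ⬝ B ⬝ (G ⬝ B.adj ⬝ W ⬝ B) := by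
    have e1 := hd.orthogonal
    have e2 := hd.eq_add
    change _ = _ + (B ⬝ (G ⬝ B.adj ⬝ W ⬝ B)).adj ⬝ W ⬝ (B ⬝ (G ⬝ B.adj ⬝ W ⬝ B))
    generalize B ⬝ (G ⬝ B.adj ⬝ W ⬝ B) = B₂ at *
    have e3 : B₁.adj ⬝ W ⬝ B₂ = 0 := by
      simpa [h.selfAdjoint, comp_assoc] using congrArg adj e1
    simp only [e2, adj_add, add_comp, AdjOp.comp_add, e1, e3]
    abel
  have h4 := h.conj_eq W (m := B₁.adj ⬝ W ⬝ B₁) h2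
  have h5 := h.conj_self V
  have h6 := h4.trans h3.symm
  clear h3 h4
  generalize X ⬝ A + G ⬝ B.adj ⬝ W ⬝ B = L at *
  rw [← h6, add_assoc, ← smul_add, mul_add, add_mul, h5, mul_smul_comm, smul_mul_assoc]

end IsComplementaryCorner

/-- `R` is chosen before the weight, so that `W` and `W'` share the same corner. -/
theorem exists_isComplementaryCorner [CompleteSpace H] [CompleteSpace K] [CompleteSpace E]
    {A : AdjOp 𝔄 H K} {B : AdjOp 𝔄 H E} (hA : A.MPInvertible)
    (hAB : (A.adj ⬝ A + B.adj ⬝ B).MPInvertible) : ∃ R : AdjOp 𝔄 H H,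
      ∀ W : AdjOp 𝔄 E E, W.PosDefinite → ∃ G, IsComplementaryCorner A B W A.mpInv R G := by
  obtain ⟨R, hR, hRR, hPR, hAR, hBp, c, hc, hle⟩ :=
    AdjOp.exists_complementary_projection hA hAB
  refine ⟨R, fun W hW => ?_⟩
  obtain ⟨G, hG⟩ := AdjOp.isCornerInverse_conj (S := B ⬝ R) hR hRR (congrArg (B ⬝ ·) hRR)
    hc hle hW
  have hX := hA.isMPInverse_mpInv
  exact ⟨G, hX.adj_right, hX.mul_mul_self, hPR, hAR, hBp, hG, hW.selfAdjoint⟩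

/-- The main theorem, for the norm and algebraic structure of the C⋆-algebra `𝓛(H)`. -/
theorem separatedDecomposition_and_limit [CompleteSpace H] [CompleteSpace K] [CompleteSpace E]
    (A : AdjOp 𝔄 H K) (B : AdjOp 𝔄 H E)
    (hA : A.MPInvertible) (hAB : (A.adj ⬝ A + B.adj ⬝ B).MPInvertible)
    (V : AdjOp 𝔄 K K) (hV : V.PosDefinite) (W : AdjOp 𝔄 E E) (hW : W.PosDefinite) :
    (∃! p : AdjOp 𝔄 H E × AdjOp 𝔄 H E, IsSeparatedDecomposition A B W p.1 p.2) ∧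
    ∀ B₁ B₂ : AdjOp 𝔄 H E, IsSeparatedDecomposition A B W B₁ B₂ →
    ∀ W' : AdjOp 𝔄 E E, W'.PosDefinite →
      (∀ t : ℝ, 0 < t →
        (A.adj ⬝ V ⬝ A + (t : ℂ) • (B.adj ⬝ W ⬝ B)).MPInvertible) ∧
      (A.adj ⬝ V ⬝ A + B₂.adj ⬝ W' ⬝ B₂).MPInvertible ∧
      (A.adj ⬝ V ⬝ A).MPInvertible ∧
      B₂.MPInvertible ∧
      ((2 : ℂ) • AdjOp.idOp 𝔄 H - A.mpInv ⬝ A - B₂.mpInv ⬝ B₂).Invertible ∧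
      Tendsto
        (fun t : ℝ => (A.adj ⬝ V ⬝ A + (t : ℂ) • (B.adj ⬝ W ⬝ B)).mpInv ⬝ A.adj ⬝ V)
        (𝓝[>] 0)
        (𝓝 ((A.adj ⬝ V ⬝ A + B₂.adj ⬝ W' ⬝ B₂).mpInv ⬝ A.adj ⬝ V)) ∧
      (A.adj ⬝ V ⬝ A + B₂.adj ⬝ W' ⬝ B₂).mpInv ⬝ A.adj ⬝ V =
        (A.adj ⬝ V ⬝ A).mpInv ⬝ A.adj ⬝ V -
          (AdjOp.idOp 𝔄 H - A.mpInv ⬝ A) ⬝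
            (((2 : ℂ) • AdjOp.idOp 𝔄 H - A.mpInv ⬝ A - B₂.mpInv ⬝ B₂).inverse ⬝
              (A.adj ⬝ V ⬝ A).mpInv ⬝ A.adj ⬝ V) := by
  obtain ⟨R, hR⟩ := exists_isComplementaryCorner hA hAB
  obtain ⟨G, h⟩ := hR W hW
  have hdec := h.isSeparatedDecomposition
  refine ⟨⟨(_, _), hdec, fun q hq => ?_⟩, fun B₁ B₂ hd W' hW' => ?_⟩
  · have e2 := h.eq_of_isSeparatedDecomposition hq
    have e1 : q.1 = B - q.2 := eq_sub_of_add_eq hq.eq_add.symm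
    rw [e2] at e1
    exact Prod.ext e1 e2
  have hB₂ := h.eq_of_isSeparatedDecomposition hd
  have hB₁ : B₁ = B - B ⬝ (G ⬝ B.adj ⬝ W ⬝ B) := by
    rw [← hB₂]; exact eq_sub_of_add_eq hd.eq_add.symm
  obtain ⟨G', h'⟩ := hR W' hW'
  have hP := h.proj_mul_proj
  obtain ⟨c, hc, hle⟩ := hA.exists_smul_le_adj_comp_self
  have hu := AdjOp.isUnit_conj_add_compl h.star_proj hP hc hle hV
  have hPA (Z : AdjOp 𝔄 H K) : (A.mpInv ⬝ A) * (A.adj ⬝ Z) = A.adj ⬝ Z :=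
    congrArg (· ⬝ Z) h.proj_comp_adj
  have hAP (Z : AdjOp 𝔄 K H) : (Z ⬝ A) * (A.mpInv ⬝ A) = Z ⬝ A :=
    congrArg (Z ⬝ ·) h.comp_proj
  have hm := IsCornerInverse.of_isUnit h.star_proj hP (hPA (V ⬝ A)) (hAP (A.adj ⬝ V)) hu
  have hB₁P : B₁ ⬝ (A.mpInv ⬝ A) = B₁ := by rw [hB₁, h.sub_comp_oblique_comp_proj]
  have hPB₁ : (A.mpInv ⬝ A) ⬝ B₁.adj = B₁.adj := by
    simpa [AdjOp.adj_eq_star (A.mpInv ⬝ A), h.star_proj] using congrArg AdjOp.adj hB₁P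
  have hmt (t : ℝ) (ht : 0 < t) : IsCornerInverse (A.mpInv ⬝ A)
      (A.adj ⬝ V ⬝ A + (t : ℂ) • (B₁.adj ⬝ W ⬝ B₁)) ((A.mpInv ⬝ A) *
        Ring.inverse (A.adj ⬝ V ⬝ A + (t : ℂ) • (B₁.adj ⬝ W ⬝ B₁) + (1 - A.mpInv ⬝ A))) := by
    refine IsCornerInverse.of_isUnit h.star_proj hP ?_ ?_ ?_
    · have e : (A.mpInv ⬝ A) * (B₁.adj ⬝ W ⬝ B₁) = B₁.adj ⬝ W ⬝ B₁ :=
        congrArg (· ⬝ W ⬝ B₁) hPB₁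
      rw [mul_add, mul_smul_comm, e, hPA]
    · have e : (B₁.adj ⬝ W ⬝ B₁) * (A.mpInv ⬝ A) = B₁.adj ⬝ W ⬝ B₁ :=
        congrArg (fun Z => B₁.adj ⬝ W ⬝ Z) hB₁P
      rw [add_mul, smul_mul_assoc, e]
      congr 1
      exact hAP (A.adj ⬝ V)
    · obtain ⟨S, hS⟩ := hV.positive
      obtain ⟨S', hS'⟩ := hW.positive
      have n1 : 0 ≤ A.adj ⬝ V ⬝ A + (1 - A.mpInv ⬝ A) :=
        add_nonneg (AdjOp.conj_nonneg (hS ▸ AdjOp.adj_comp_self_nonneg S) A)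
          (one_sub_nonneg_of_isProj h.star_proj hP)
      have n2 : 0 ≤ (t : ℂ) • (B₁.adj ⬝ W ⬝ B₁) := by
        rw [Complex.coe_smul]
        exact smul_nonneg ht.le
          (AdjOp.conj_nonneg (hS' ▸ AdjOp.adj_comp_self_nonneg S') B₁)
      -- Adding the positive term `t B₁*WB₁` preserves the lower bound, hence invertibility.
      refine CStarAlgebra.isUnit_of_le _ ?_ (hu.isStrictlyPositive n1)
      rw [add_right_comm]
      exact le_add_of_nonneg_right n2
  have hpt (t : ℝ) (ht : 0 < t) := h.isCornerInverse_add (hmt t ht)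
    (h.corner.smul (Complex.ofReal_ne_zero.2 ht.ne'))
  have hpt' (t : ℝ) (ht : 0 < t) := h.conj_weighted_sum t V hB₁ ▸ hpt t ht
  have hp' := h.conj_eq W' (h.conj_self V) ▸ h.isCornerInverse_add hm h'.corner
  have hB₂' : (B ⬝ (G ⬝ B.adj ⬝ W ⬝ B)).adj ⬝ W' ⬝ B ⬝ (G ⬝ B.adj ⬝ W ⬝ B) =
      B₂.adj ⬝ W' ⬝ B₂ := by rw [hB₂]
  rw [hB₂'] at hp'
  have hB₂MP : B₂.MPInvertible := by
    rw [hB₂]; exact AdjOp.mpInvertible_of_comp_comp_self h.comp_inner_inverse_comp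
  have hX₂ := hB₂MP.isMPInverse_mpInv
  have hFB₂ : G ⬝ B.adj ⬝ W ⬝ B₂ = G ⬝ B.adj ⬝ W ⬝ B := by
    rw [hB₂]; exact h.oblique_mul_oblique
  have hgap : IsUnit ((2 : ℂ) • AdjOp.idOp 𝔄 H - A.mpInv ⬝ A - B₂.mpInv ⬝ B₂) := by
    refine h.isUnit_gap hX₂.adj_right (congrArg (B₂.mpInv ⬝ ·) hX₂.mul_mul_self) ?_
    have e : (G ⬝ B.adj ⬝ W ⬝ B) *
        (A.mpInv ⬝ A - (G ⬝ B.adj ⬝ W ⬝ B) * (A.mpInv ⬝ A)) = 0 := by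
      rw [mul_sub, ← mul_assoc, h.oblique_mul_oblique, sub_self]
    -- `B₂ = BF` kills `(1 - F)P`, and so does `B₂†B₂`.
    have e' : B₂ ⬝ (A.mpInv ⬝ A - (G ⬝ B.adj ⬝ W ⬝ B) * (A.mpInv ⬝ A)) = 0 := by
      nth_rw 1 [hB₂]
      exact (congrArg (B ⬝ ·) e).trans (AdjOp.comp_zero B)
    exact (congrArg (B₂.mpInv ⬝ ·) e').trans (AdjOp.comp_zero _)
  have hinv := (AdjOp.invertible_iff_isUnit.2 hgap).isInverse_inverse
  have hlim := h.inverse_comp_adj hm h'.corner V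
  rw [← hp'.isMPInverse.mpInv_eq] at hlim
  refine ⟨fun t ht => ⟨_, (hpt' t ht).isMPInverse⟩, ⟨_, hp'.isMPInverse⟩,
    ⟨_, hm.isMPInverse⟩, hB₂MP, AdjOp.invertible_iff_isUnit.2 hgap, ?_, ?_⟩
  · rw [hlim]
    set f : AdjOp 𝔄 H H → AdjOp 𝔄 K H := fun x =>
      x ⬝ A.adj ⬝ V - (G ⬝ B.adj ⬝ W ⬝ B) ⬝ x ⬝ A.adj ⬝ V with hf
    have hfc : Continuous f :=
      (AdjOp.continuous_comp_right _).sub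
        ((AdjOp.continuous_comp_left _).comp (AdjOp.continuous_comp_right _))
    have hz : Tendsto (fun t : ℝ => A.adj ⬝ V ⬝ A + (t : ℂ) • (B₁.adj ⬝ W ⬝ B₁) +
        (1 - A.mpInv ⬝ A)) (𝓝[>] 0) (𝓝 (A.adj ⬝ V ⬝ A + (1 - A.mpInv ⬝ A))) := by
      have : Continuous fun t : ℝ => A.adj ⬝ V ⬝ A + (t : ℂ) • (B₁.adj ⬝ W ⬝ B₁) +
          (1 - A.mpInv ⬝ A) := by fun_prop
      have := this.tendsto 0
      simp only [Complex.ofReal_zero, zero_smul, add_zero] at this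
      exact this.mono_left nhdsWithin_le_nhds
    -- Adding `1 - P` turns the corner inverse into an ordinary inverse, continuous at the unit
    -- `A*VA + (1 - P)`.
    have hi := (NormedRing.inverse_continuousAt hu.unit).tendsto.comp hz
    refine ((hfc.tendsto _).comp (hi.const_mul (A.mpInv ⬝ A))).congr' ?_
    filter_upwards [self_mem_nhdsWithin] with t ht
    rw [(hpt' t ht).isMPInverse.mpInv_eq]
    exact (h.inverse_comp_adj (hmt t ht)
      (h.corner.smul (Complex.ofReal_ne_zero.2 (ne_of_gt ht))) V).symm
  · rw [hlim, ← hm.isMPInverse.mpInv_eq]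
    congr 1
    have hx := hm.proj_mul_inv
    rw [← hm.isMPInverse.mpInv_eq] at hx
    have e := h.compl_mul_inverse_gap (P₂ := B₂.mpInv ⬝ B₂)
      (S := ((2 : ℂ) • AdjOp.idOp 𝔄 H - A.mpInv ⬝ A - B₂.mpInv ⬝ B₂).inverse) ?_ ?_ hinv.2
    · have e' := congrArg (· * (A.adj ⬝ V ⬝ A).mpInv) e
      simp only [mul_assoc, hx] at e'
      exact congrArg (· ⬝ A.adj ⬝ V) e'.symm
    · rw [← hFB₂]
      exact congrArg (G ⬝ B.adj ⬝ W ⬝ ·) hX₂.mul_mul_self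
    · have e1 : B₂ ⬝ (A.mpInv ⬝ A + R) = B₂ := by
        rw [hB₂]; exact congrArg (B ⬝ ·) h.oblique_mul_add
      have e2 : (B₂.mpInv ⬝ B₂) * (A.mpInv ⬝ A + R) = B₂.mpInv ⬝ B₂ :=
        congrArg (B₂.mpInv ⬝ ·) e1
      have e3 := congrArg star e2
      have e4 : star (B₂.mpInv ⬝ B₂) = B₂.mpInv ⬝ B₂ := hX₂.adj_right
      rwa [star_mul, star_add, h.star_proj, h.star_compl, e4] at e3

end HilbertModuleLimit

theorem mainTheorem10
    {𝔄 : Type*} [NonUnitalCStarAlgebra 𝔄] [PartialOrder 𝔄] [StarOrderedRing 𝔄]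
    {H : Type*} [NormedAddCommGroup H] [NormedSpace ℂ H] [SMul 𝔄 H] [CStarModule 𝔄 H]
    [CompleteSpace H]
    {K : Type*} [NormedAddCommGroup K] [NormedSpace ℂ K] [SMul 𝔄 K] [CStarModule 𝔄 K]
    [CompleteSpace K]
    {E : Type*} [NormedAddCommGroup E] [NormedSpace ℂ E] [SMul 𝔄 E] [CStarModule 𝔄 E]
    [CompleteSpace E]
    (A : AdjOp 𝔄 H K) (B : AdjOp 𝔄 H E)
    (hA : A.MPInvertible) (hAB : (A.adj ⬝ A + B.adj ⬝ B).MPInvertible)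
    (V : AdjOp 𝔄 K K) (hV : V.PosDefinite) (W : AdjOp 𝔄 E E) (hW : W.PosDefinite) :
    -- the decomposition exists and is unique
    (∃! p : AdjOp 𝔄 H E × AdjOp 𝔄 H E, IsSeparatedDecomposition A B W p.1 p.2) ∧
    ∀ B₁ B₂ : AdjOp 𝔄 H E, IsSeparatedDecomposition A B W B₁ B₂ →
    ∀ W' : AdjOp 𝔄 E E, W'.PosDefinite →
      -- every inverse in the formulas is a genuine one
      (∀ t : ℝ, 0 < t →
        (A.adj ⬝ V ⬝ A + (t : ℂ) • (B.adj ⬝ W ⬝ B)).MPInvertible) ∧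
      (A.adj ⬝ V ⬝ A + B₂.adj ⬝ W' ⬝ B₂).MPInvertible ∧
      (A.adj ⬝ V ⬝ A).MPInvertible ∧
      B₂.MPInvertible ∧
      ((2 : ℂ) • AdjOp.idOp 𝔄 H - A.mpInv ⬝ A - B₂.mpInv ⬝ B₂).Invertible ∧
      -- the limit formula, in the operator norm
      Tendsto
        (fun t : ℝ => (A.adj ⬝ V ⬝ A + (t : ℂ) • (B.adj ⬝ W ⬝ B)).mpInv ⬝ A.adj ⬝ V)
        (𝓝[>] 0)
        (𝓝 ((A.adj ⬝ V ⬝ A + B₂.adj ⬝ W' ⬝ B₂).mpInv ⬝ A.adj ⬝ V)) ∧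
      -- the closed form of the limit
      (A.adj ⬝ V ⬝ A + B₂.adj ⬝ W' ⬝ B₂).mpInv ⬝ A.adj ⬝ V =
        (A.adj ⬝ V ⬝ A).mpInv ⬝ A.adj ⬝ V -
          (AdjOp.idOp 𝔄 H - A.mpInv ⬝ A) ⬝
            (((2 : ℂ) • AdjOp.idOp 𝔄 H - A.mpInv ⬝ A - B₂.mpInv ⬝ B₂).inverse ⬝
              (A.adj ⬝ V ⬝ A).mpInv ⬝ A.adj ⬝ V) :=
  separatedDecomposition_and_limit A B hA hAB V hV W hW
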